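/- **Setting.** Let $X$ (women) and $Y$ (men) be finite sets with $|X|=|Y|=n$. Each player holds a preference list, i.e. a linear order on a subset of the members of the opposite sex; the lists $P$ are symmetric ($m$ is on the list of $w$ if and only if $w$ is on the list of $m$). Let $E$ be the set of pairs $(m,w)$ that rank each other, and let $\deg v$ be the length of the list of $v$. A matching is a set $M\subseteq E$ of pairwise disjoint pairs. A pair $(m,w)\in E\setminus M$ is blocking for $M$ if each of $m$, $w$ prefers the other to its partner in $M$ (an unmatched player prefers every acceptable partner to being unmatched). $M$ is $(1-\varepsilon)$-stable if it has at most $\varepsilon|E|$ blocking pairs. $P$ is $\alpha$-almost-regular if $\max_{m\in Y}\deg m\le\alpha\min_{m\in Y}\deg m$, and complete if every player ranks all players of the opposite sex. Algorithms are randomized distributed algorithms in the CONGEST model on the communication graph with edge set $E$: each player is a processor that initially knows only its gender, its unique identifier, its own preference list (as identifiers), the parameters $\varepsilon,\delta,\alpha$ and an upper bound $N\ge n$. In each synchronous round a processor receives the messages sent to it in the previous round, draws private randomness, performs an arbitrary local computation, and sends a (possibly different) message of $O(\log n)$ bits to each of its neighbours (for $n=1$, of $O(1)$ bits). At the end each processor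 outputs its partner, or that it has none. **Theorem.** There exists a randomized distributed algorithm $\mathbf{AlmostRegularASM}(P,\varepsilon,\delta,\alpha)$ which, for all $\varepsilon,\delta>0$ and $\alpha\ge1$, finds a $(1-\varepsilon)$-stable matching with probability at least $1-\delta$ on all $\alpha$-almost-regular preferences $P$; in particular on all complete preferences, which are $\alpha$-almost-regular for every $\alpha\ge 1$. It runs for a number of rounds that depends only on $\varepsilon,\delta,\alpha$ (and not on $n$), and this number is at most $$C\,\alpha\,\varepsilon^{-3}\log\!\Big(2+\frac{\alpha}{\delta\varepsilon}\Big)$$ for an absolute constant $C$; the constant in the message length is absolute as well. -/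

import Mathlib

/-! ### Preferences, matchings, almost stability

`X` is the set of women and `Y` the set of men; edges are pairs (man, woman). -/

/-- Symmetric, possibly incomplete preferences: every player holds a list without repetitions of
acceptable partners of the opposite sex, most favoured first. -/
structure Preferences (X Y : Type*) where
  /-- the preference list of a woman -/
  ofWoman : X → List Y
  /-- the preference list of a man -/
  ofMan : Y → List X
  nodup_ofWoman : ∀ w, (ofWoman w).Nodup
  nodup_ofMan : ∀ m, (ofMan m).Nodup
  symmetric : ∀ m w, m ∈ ofWoman w ↔ w ∈ ofMan m

namespace Preferences

variable {X Y : Type*}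

/-- The edges of the communication graph. -/
def edges (P : Preferences X Y) : Set (Y × X) := {e | e.2 ∈ P.ofMan e.1}

/-- Every player ranks all players of the opposite sex. -/
def IsComplete (P : Preferences X Y) : Prop :=
  (∀ w m, m ∈ P.ofWoman w) ∧ (∀ m w, w ∈ P.ofMan m)

/-- The largest degree of a man is at most `α` times the smallest degree of a man. -/
def IsAlmostRegular (P : Preferences X Y) (α : ℝ) : Prop :=
  ∀ m m' : Y, ((P.ofMan m).length : ℝ) ≤ α * ((P.ofMan m').length : ℝ)

/-- A set of edges of the communication graph, no two of which share a vertex. -/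
def IsMatching (P : Preferences X Y) (M : Set (Y × X)) : Prop :=
  M ⊆ P.edges ∧ ∀ e ∈ M, ∀ f ∈ M, (e.1 = f.1 ∨ e.2 = f.2) → e = f

/-- The blocking pairs of `M`: edges outside `M` whose two endpoints both prefer each other to
their partner in `M`, if they have one. -/
def blockingPairs [DecidableEq X] [DecidableEq Y] (P : Preferences X Y) (M : Set (Y × X)) :
    Set (Y × X) :=
  {e | e ∈ P.edges ∧ e ∉ M ∧
    (∀ w', (e.1, w') ∈ M → (P.ofMan e.1).idxOf e.2 < (P.ofMan e.1).idxOf w') ∧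
    (∀ m', (m', e.2) ∈ M → (P.ofWoman e.2).idxOf e.1 < (P.ofWoman e.2).idxOf m')}

/-- `M` is a `(1 - ε)`-stable matching. -/
def IsAlmostStable [DecidableEq X] [DecidableEq Y] (P : Preferences X Y) (ε : ℝ)
    (M : Set (Y × X)) : Prop :=
  P.IsMatching M ∧ ((P.blockingPairs M).ncard : ℝ) ≤ ε * (P.edges.ncard : ℝ)

/-- The acceptable partners of a player (`Sum.inl` for men, `Sum.inr` for women), most favoured
first; these are the neighbours of the player in the communication graph. -/
def neighbors (P : Preferences X Y) : Y ⊕ X → List (Y ⊕ X)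
  | Sum.inl m => (P.ofMan m).map Sum.inr
  | Sum.inr w => (P.ofWoman w).map Sum.inl

end Preferences

/-! ### Randomized distributed algorithms in the CONGEST model -/

inductive Gender where
  | man
  | woman

/-- What a processor knows before the first round. -/
structure LocalInput where
  gender : Gender
  /-- its own identifier -/
  ident : ℕ
  /-- its preference list, as the identifiers of its neighbours, most favoured first -/
  prefs : List ℕ
  /-- an upper bound on the number of men (which is the number of women) -/
  sizeBound : ℕ

/-- A message is a string of bits. A family of messages, indexed by the identifiers of the
addressees (for sent messages) or of the senders (for received messages); `none` means that there
is no message. -/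
abbrev Mail := ℕ → Option (List Bool)

/-- A synchronous randomized distributed algorithm in which all processors run the same program.
It runs for a fixed number of rounds. In each round, each processor receives the messages that
were sent to it in the previous round, draws a private random number, changes its state by an
arbitrary local computation, and sends messages. -/
structure RandomizedAlgorithm where
  /-- the internal states of a processor -/
  State : Type
  /-- the number of rounds -/
  rounds : ℕ
  /-- the random number of a processor in a round is uniform on `{0, …, randBound N}`, where `N`
  is the bound on the size of the instance that the processors know -/
  randBound : ℕ → ℕ
  /-- the state before the first round -/
  init : LocalInput → State
  /-- one round of a processor: from its state, the received messages and the random number to the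
  new state and the sent messages -/
  step : State → Mail → ℕ → State × Mail
  /-- the identifier of the partner (if any) that the processor announces at the end -/
  output : State → Option ℕ

namespace RandomizedAlgorithm

variable {X Y : Type*}

/-- The local input of a player. -/
def localInput (P : Preferences X Y) (ident : Y ⊕ X → ℕ) (N : ℕ) (v : Y ⊕ X) : LocalInput where
  gender := match v with
    | Sum.inl _ => Gender.man
    | Sum.inr _ => Gender.woman
  ident := ident v
  prefs := (P.neighbors v).map ident
  sizeBound := N

/-- Delivery along the edges of the communication graph: the messages that `v` receives when every
player `u` sends `sent u`. A message to a player who is not a neighbour is lost. -/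
def deliver (P : Preferences X Y) (ident : Y ⊕ X → ℕ) (sent : Y ⊕ X → Mail) (v : Y ⊕ X) : Mail :=
  fun i => ((P.neighbors v).find? (fun u => ident u == i)).bind (fun u => sent u (ident v))

/-- The outcomes of all random draws, one for each player and each round. -/
abbrev Draws (A : RandomizedAlgorithm) (X Y : Type*) (N : ℕ) :=
  Y ⊕ X → Fin A.rounds → Fin (A.randBound N + 1)

/-- The state of each player after `t` rounds, with the messages it sent in the last of them. -/
def run (A : RandomizedAlgorithm) (P : Preferences X Y) (ident : Y ⊕ X → ℕ) (N : ℕ)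
    (ω : A.Draws X Y N) : ℕ → Y ⊕ X → A.State × Mail
  | 0 => fun v => (A.init (localInput P ident N v), fun _ => none)
  | t + 1 => fun v =>
      A.step (A.run P ident N ω t v).1
        (deliver P ident (fun u => (A.run P ident N ω t u).2) v)
        (if h : t < A.rounds then (ω v ⟨t, h⟩ : ℕ) else 0)

/-- In every execution on the instance, every message sent to a neighbour has at most `b` bits. -/
def RespectsBandwidth (A : RandomizedAlgorithm) (P : Preferences X Y) (ident : Y ⊕ X → ℕ) (N : ℕ)
    (b : ℕ) : Prop :=
  ∀ (ω : A.Draws X Y N) (t : ℕ), t ≤ A.rounds → ∀ v, ∀ u ∈ P.neighbors v,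
    ∀ s ∈ (A.run P ident N ω t v).2 (ident u), s.length ≤ b

/-- The outputs of the players after the last round describe the set `M` of pairs: each player
announces the partner it has in `M`, or that it has none. -/
def Outputs (A : RandomizedAlgorithm) (P : Preferences X Y) (ident : Y ⊕ X → ℕ) (N : ℕ)
    (ω : A.Draws X Y N) (M : Set (Y × X)) : Prop :=
  (∀ m i, A.output (A.run P ident N ω A.rounds (Sum.inl m)).1 = some i ↔
    ∃ w, (m, w) ∈ M ∧ ident (Sum.inr w) = i) ∧
  (∀ w i, A.output (A.run P ident N ω A.rounds (Sum.inr w)).1 = some i ↔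
    ∃ m, (m, w) ∈ M ∧ ident (Sum.inl m) = i)

open Classical in
/-- The probability, over independent uniform draws, that the algorithm outputs a
`(1 - ε)`-stable matching. -/
noncomputable def successProbability [Fintype X] [Fintype Y] [DecidableEq X] [DecidableEq Y]
    (A : RandomizedAlgorithm) (P : Preferences X Y) (ident : Y ⊕ X → ℕ) (N : ℕ) (ε : ℝ) : ℝ :=
  (Fintype.card {ω : A.Draws X Y N // ∃ M, P.IsAlmostStable ε M ∧ A.Outputs P ident N ω M} : ℝ) /
    (Fintype.card (A.Draws X Y N) : ℝ)

end RandomizedAlgorithm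

open Preferences RandomizedAlgorithm

set_option linter.unusedSectionVars false

/-! Deferred acceptance becomes fast when every list is cut into `k` quantiles and preferences
within a quantile are ignored. In one call, each unmatched man proposes to all women in the best of
his quantiles that still contains a woman who has not rejected him. Women answer by their own
quantiles, best first: the proposals in quantile `i` form a residual graph, in which an almost
maximal matching is computed by `T` randomized iterations. A matched woman rejects every man who is
not in a strictly better quantile than her partner.

Progress is measured by `potW + potM`, which is at most `2kn`. Call a man bad if he is unmatched but
not rejected by everybody. During a call, each man who was bad at its beginning either gets matched,
which moves some woman up a quantile, or exhausts a quantile of his own (`Call.pot_le`). The number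
of bad men never grows (`Call.card_bad_le`), so at most `2kn/L` are bad after `L` calls; by almost
regularity they own at most a fraction `2kα/L` of the edges.

Since the matchings are not quite maximal, the leftover residual edges are deleted without
justification; these are the lost edges. A blocking pair belongs to a bad man, or shares a quantile
with the partner of one of its ends, or is lost (`Inv.blocking_subset`). Pairs of the second kind
number at most `2|E|/k`. An iteration removes a sixteenth of the residual edges in expectation
(`sum_hit`, `sum_card_iter_res`), so at most `Lk(15/16)^T|E|` edges are lost in expectation, and
Markov's inequality applies. With `k ≈ 8/ε`, `L ≈ 8kα/ε` and `T` logarithmic, the three kinds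
contribute at most `ε/4 + ε/4 + ε/2` of the edges, outside an event of probability `δ`; the number
of rounds is of order `LkT`.

The combinatorics is carried out on global states (`Core`), which `Rep` ties to the local states of
the processors; `Rep.iter` is the main simulation step. Expectations are handled by `Bounded`, an
estimate linear in the numbers of lost and residual edges that is propagated backwards through the
program. -/

namespace QuantileMatching

/-! ### The algorithm -/

/-- The part of the state of a processor that changes during the execution. -/
structure Loc where
  /-- the current partner -/
  partner : Option ℕ
  /-- the women that have not rejected this man -/
  live : Finset ℕ
  /-- the women to which this man proposes in the current call of the quantile matching -/
  act : Finset ℕ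
  /-- the neighbours in the residual graph of the maximal matching procedure -/
  resid : Finset ℕ
  /-- the neighbour picked in the current iteration of the maximal matching procedure -/
  pick : Option ℕ
  /-- the addressees of the one-bit message that is sent at the end of the round -/
  out : Finset ℕ

/-- The rounds of the algorithm are of nine kinds. -/
inductive Instr where
  | reset
  | propose
  | accept (i : ℕ)
  | hear
  | draw
  | reply
  | confirm
  | heed
  | clean

/-- The quantile, out of `k`, of the entry `a` of the preference list `l`. -/
def quantile {ι : Type*} [DecidableEq ι] (k : ℕ) (l : List ι) (a : ι) : ℕ :=
  l.idxOf a * k / l.length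

/-- The neighbours with whom a processor does not want to be matched any more: for a man all except
his partner, for a woman those who are not in a better quantile than her partner. -/
def refused (k : ℕ) (inp : LocalInput) : Option ℕ → Finset ℕ
  | none => ∅
  | some p =>
    match inp.gender with
    | .man => inp.prefs.toFinset.filter fun i => i ≠ p
    | .woman => inp.prefs.toFinset.filter fun i =>
        i ≠ p ∧ quantile k inp.prefs p ≤ quantile k inp.prefs i

/-- The local computation of a processor in a round of a given kind. -/
def Instr.exec (k : ℕ) (inp : LocalInput) (s : Loc) (inbox : Finset ℕ) (r : ℕ) : Instr → Loc
  | reset =>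
    match inp.gender with
    | .man => { s with
        act := if s.partner = none then
          s.live.filter fun w => ∀ w' ∈ s.live, quantile k inp.prefs w ≤ quantile k inp.prefs w'
          else ∅ }
    | .woman => s
  | propose =>
    match inp.gender with
    | .man => { s with out := s.act ∩ s.live }
    | .woman => { s with out := ∅ }
  | accept i =>
    match inp.gender with
    | .man => { s with out := ∅ }
    | .woman => { s with
        resid := inbox.filter fun m => quantile k inp.prefs m = i
        out := inbox.filter fun m => quantile k inp.prefs m = i }
  | hear =>
    match inp.gender with
    | .man => { s with resid := inbox }
    | .woman => s
  -- With `d > 0` residual neighbours, a residue below `d` selects the neighbour of that rank and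
  -- any other residue selects nobody, so a processor abstains with probability one half. An empty
  -- residual set gives an empty list, hence no pick.
  | draw => { s with
      pick := (s.resid.sort (· ≤ ·))[r % (2 * s.resid.card)]?
      out := ((s.resid.sort (· ≤ ·))[r % (2 * s.resid.card)]?).toFinset }
  | reply =>
    -- Only processors that picked nobody reply, so nobody is both picker and replier, and the new
    -- pairs are disjoint.
    if h : s.pick = none ∧ inbox.Nonempty then
      { s with
        partner := some (inbox.min' h.2)
        act := ∅
        resid := ∅
        out := {inbox.min' h.2} }
    else { s with out := ∅ }
  | confirm =>
    let s' : Loc := if ∃ u ∈ s.pick, u ∈ inbox then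
      { s with partner := s.pick, act := ∅, resid := ∅ } else s
    { s' with out := refused k inp s'.partner }
  | heed =>
    match inp.gender with
    | .man => { s with
        live := s.live \ inbox
        resid := s.resid \ inbox
        partner := s.partner.filter fun p => p ∉ inbox }
    | .woman => { s with resid := s.resid \ inbox }
  | clean =>
    match inp.gender with
    | .man => { s with resid := ∅, out := ∅ }
    | .woman => { s with resid := ∅, out := s.resid }

/-- The state before the first round. -/
def Loc.init (inp : LocalInput) : Loc where
  partner := none
  live := inp.prefs.toFinset
  act := ∅
  resid := ∅
  pick := none
  out := ∅

/-- The messages sent by a processor: one bit to each addressee. -/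
def Loc.mail (s : Loc) : Mail := fun i => if i ∈ s.out then some [true] else none

/-- The neighbours from which a processor has received a message. -/
def senders (inp : LocalInput) (mail : Mail) : Finset ℕ :=
  inp.prefs.toFinset.filter fun i => (mail i).isSome

/-- The distributed algorithm that executes a list of instructions, one in each round. -/
abbrev algorithm (k : ℕ) (prog : List Instr) : RandomizedAlgorithm where
  State := LocalInput × List Instr × Loc
  rounds := prog.length
  -- There are `2 * N!` values, so reduction modulo `2d` is exactly uniform for every degree `1 ≤ d
  -- ≤ N`.
  randBound N := 2 * N.factorial - 1
  init inp := (inp, prog, Loc.init inp)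
  step s mail r :=
    match s with
    | (inp, [], s) => ((inp, [], s), s.mail)
    | (inp, i :: p, s) =>
      ((inp, p, i.exec k inp s (senders inp mail) r), (i.exec k inp s (senders inp mail) r).mail)
  output s := s.2.2.partner

/-- One iteration of the maximal matching procedure. -/
def iterProg : List Instr := [.draw, .reply, .confirm, .heed]

/-- `T` iterations of the maximal matching procedure. -/
def matchProg : ℕ → List Instr
  | 0 => []
  | T + 1 => iterProg ++ matchProg T

/-- Proposals to the women who rank the proposer in the quantile `i`. -/
def roundProg (T i : ℕ) : List Instr :=
  [.propose, .accept i, .hear] ++ (matchProg T ++ [.clean, .heed])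

/-- The last `j` of the `k` proposal rounds of a call of the quantile matching. -/
def levelsProg (T k : ℕ) : ℕ → List Instr
  | 0 => []
  | j + 1 => roundProg T (k - (j + 1)) ++ levelsProg T k j

/-- `L` calls of the quantile matching. -/
def callsProg (T k : ℕ) : ℕ → List Instr
  | 0 => []
  | L + 1 => .reset :: (levelsProg T k k ++ callsProg T k L)

theorem length_matchProg (T : ℕ) : (matchProg T).length = 4 * T := by
  induction T with
  | zero => rfl
  | succ T ih => simp [matchProg, iterProg, ih]; omega

theorem length_levelsProg (T k j : ℕ) : (levelsProg T k j).length = j * (4 * T + 5) := by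
  induction j with
  | zero => simp [levelsProg]
  | succ j ih => simp [levelsProg, roundProg, length_matchProg, ih]; ring

theorem length_callsProg (T k L : ℕ) :
    (callsProg T k L).length = L * (k * (4 * T + 5) + 1) := by
  induction L with
  | zero => simp [callsProg]
  | succ L ih => simp [callsProg, length_levelsProg, ih]; ring

/-! ### Executions of a list of instructions -/

section Execution

variable {X Y : Type*}

/-- The identifiers of the players from which `v` receives a message. -/
def inbox (P : Preferences X Y) (ident : Y ⊕ X → ℕ) (N : ℕ) (σ : Y ⊕ X → Loc) (v : Y ⊕ X) :
    Finset ℕ :=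
  senders (localInput P ident N v) (deliver P ident (fun u => (σ u).mail) v)

/-- One round of all processors. -/
def gstep (k : ℕ) (P : Preferences X Y) (ident : Y ⊕ X → ℕ) (N : ℕ) (i : Instr)
    (σ : Y ⊕ X → Loc) (r : Y ⊕ X → ℕ) : Y ⊕ X → Loc :=
  fun v => i.exec k (localInput P ident N v) (σ v) (inbox P ident N σ v) (r v)

/-- The execution of a list of instructions with given random numbers. -/
def gexec (k : ℕ) (P : Preferences X Y) (ident : Y ⊕ X → ℕ) (N : ℕ) :
    List Instr → (Y ⊕ X → Loc) → (ℕ → Y ⊕ X → ℕ) → Y ⊕ X → Loc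
  | [], σ, _ => σ
  | i :: p, σ, c => gexec k P ident N p (gstep k P ident N i σ (c 0)) fun t => c (t + 1)

variable (k : ℕ) (P : Preferences X Y) (ident : Y ⊕ X → ℕ) (N : ℕ)

theorem gexec_append (p q : List Instr) (σ : Y ⊕ X → Loc) (c : ℕ → Y ⊕ X → ℕ) :
    gexec k P ident N (p ++ q) σ c =
      gexec k P ident N q (gexec k P ident N p σ c) fun t => c (t + p.length) := by
  induction p generalizing σ c with
  | nil => rfl
  | cons i p ih =>
    simp only [List.cons_append, gexec, ih, List.length_cons]
    congr 1

/-- The random numbers of an execution, extended by zero. -/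
def extend {L R : ℕ} (ω : Fin L → Y ⊕ X → Fin R) : ℕ → Y ⊕ X → ℕ :=
  fun t v => if h : t < L then (ω ⟨t, h⟩ v : ℕ) else 0

/-- The initial states of all players. -/
def ginit : Y ⊕ X → Loc := fun v => Loc.init (localInput P ident N v)

/-- Reduces the CONGEST model to the interpreter `gexec`: the mail is always determined by `out`,
which is empty at the start, in accordance with the absence of messages before the first round. -/
theorem run_algorithm (prog : List Instr) (ω : (algorithm k prog).Draws X Y N) (t : ℕ)
    (v : Y ⊕ X) :
    (algorithm k prog).run P ident N ω t v =
      ((localInput P ident N v, prog.drop t,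
        gexec k P ident N (prog.take t) (ginit P ident N) (extend fun s u => ω u s) v),
       (gexec k P ident N (prog.take t) (ginit P ident N) (extend fun s u => ω u s) v).mail) := by
  induction t generalizing v with
  | zero =>
    simp only [run, List.take_zero, List.drop_zero, gexec]
    refine Prod.ext rfl ?_
    funext i
    simp [ginit, Loc.mail, Loc.init]
  | succ t ih =>
    have hd : (fun u => ((algorithm k prog).run P ident N ω t u).2) = fun u =>
        (gexec k P ident N (prog.take t) (ginit P ident N) (extend fun s u => ω u s) u).mail := by
      funext u
      rw [ih u]
    change (algorithm k prog).step ((algorithm k prog).run P ident N ω t v).1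
      (deliver P ident (fun u => ((algorithm k prog).run P ident N ω t u).2) v) _ = _
    rw [hd, ih v]
    by_cases h : t < prog.length
    · rw [List.drop_eq_getElem_cons h, List.take_succ_eq_append_getElem h, gexec_append]
      have hl : (prog.take t).length = t := by simp [h.le]
      have he : (if h' : t < (algorithm k prog).rounds then (ω v ⟨t, h'⟩ : ℕ) else 0) =
          extend (fun s u => ω u s) t v := rfl
      simp only [gexec, hl, zero_add, he]
      rfl
    · have h1 : prog.drop t = [] := List.drop_eq_nil_of_le (by omega)
      have h2 : prog.drop (t + 1) = [] := List.drop_eq_nil_of_le (by omega)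
      have h3 : prog.take (t + 1) = prog.take t := by
        rw [List.take_of_length_le (by omega), List.take_of_length_le (by omega)]
      rw [h1, h2, h3]

theorem respectsBandwidth_algorithm (prog : List Instr) (b : ℕ) (hb : 1 ≤ b) :
    (algorithm k prog).RespectsBandwidth P ident N b := by
  intro ω t _ v u _ s hs
  rw [run_algorithm] at hs
  simp only [Loc.mail, Option.mem_def] at hs
  split_ifs at hs
  cases hs
  simpa using hb

/-! ### Averaging over the random draws, one round at a time -/

section Expectation

variable [Fintype X] [Fintype Y] [DecidableEq X] [DecidableEq Y]

/-- The expectation of `f` in the final state of the execution of a list of instructions, with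
independent random numbers uniform on `{0, …, R - 1}`. -/
noncomputable def expect (R : ℕ) :
    List Instr → (Y ⊕ X → Loc) → ((Y ⊕ X → Loc) → ℝ) → ℝ
  | [], σ, f => f σ
  | i :: p, σ, f =>
    (∑ r : Y ⊕ X → Fin R, expect R p (gstep k P ident N i σ fun v => r v) f) /
      (Fintype.card (Y ⊕ X → Fin R) : ℝ)

/-- Fubini: separating the draws of the first round from the later ones turns the uniform average
over executions into the nested averages of `expect`. -/
theorem sum_gexec {R : ℕ} (hR : 0 < R) (p : List Instr) (σ : Y ⊕ X → Loc)
    (f : (Y ⊕ X → Loc) → ℝ) :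
    ∑ ω : Fin p.length → Y ⊕ X → Fin R, f (gexec k P ident N p σ (extend ω)) =
      expect k P ident N R p σ f *
        (Fintype.card (Fin p.length → Y ⊕ X → Fin R) : ℝ) := by
  induction p generalizing σ with
  | nil => simp [gexec, expect]
  | cons i p ih =>
    have : NeZero R := ⟨hR.ne'⟩
    simp only [List.length_cons]
    rw [← (Fin.consEquiv fun _ : Fin (p.length + 1) => Y ⊕ X → Fin R).sum_comp,
      Fintype.sum_prod_type]
    have h1 : ∀ (r : Y ⊕ X → Fin R) (ω : Fin p.length → Y ⊕ X → Fin R),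
        gexec k P ident N (i :: p) σ
          (extend ((Fin.consEquiv fun _ : Fin (p.length + 1) => Y ⊕ X → Fin R) (r, ω))) =
        gexec k P ident N p (gstep k P ident N i σ fun v => r v) (extend ω) := by
      intro r ω
      rw [gexec]
      congr 1
      funext t v
      by_cases h : t < p.length
      · simp only [extend, h, Nat.add_lt_add_iff_right, dif_pos]
        rfl
      · simp [extend, h]
    simp only [h1, ih]
    rw [expect, ← Finset.sum_mul, Fintype.card_congr
      (Fin.consEquiv fun _ : Fin (p.length + 1) => Y ⊕ X → Fin R).symm, Fintype.card_prod]
    have hc : (Fintype.card (Y ⊕ X → Fin R) : ℝ) ≠ 0 := by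
      exact_mod_cast Fintype.card_ne_zero
    push_cast
    field_simp

open Classical in
/-- The success probability as an expectation. -/
theorem successProbability_algorithm (prog : List Instr) (ε : ℝ) :
    (algorithm k prog).successProbability P ident N ε =
      1 - expect k P ident N (2 * N.factorial) prog (ginit P ident N) fun σ =>
        if ∃ M, P.IsAlmostStable ε M ∧
          (∀ m i, (σ (Sum.inl m)).partner = some i ↔ ∃ w, (m, w) ∈ M ∧ ident (Sum.inr w) = i) ∧
          (∀ w i, (σ (Sum.inr w)).partner = some i ↔ ∃ m, (m, w) ∈ M ∧ ident (Sum.inl m) = i)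
        then 0 else 1 := by
  have hR : 2 * N.factorial - 1 + 1 = 2 * N.factorial := by
    have := N.factorial_pos
    omega
  rw [← hR]
  set C : (Y ⊕ X → Loc) → Prop := fun σ => ∃ M, P.IsAlmostStable ε M ∧
    (∀ m i, (σ (Sum.inl m)).partner = some i ↔ ∃ w, (m, w) ∈ M ∧ ident (Sum.inr w) = i) ∧
    (∀ w i, (σ (Sum.inr w)).partner = some i ↔ ∃ m, (m, w) ∈ M ∧ ident (Sum.inl m) = i) with hC
  set f : (Y ⊕ X → Loc) → ℝ := fun σ => if C σ then 0 else 1 with hf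
  have hs := sum_gexec k P ident N (R := 2 * N.factorial - 1 + 1) (by omega) prog
    (ginit P ident N) f
  have hcard : (Fintype.card (Fin prog.length → Y ⊕ X → Fin (2 * N.factorial - 1 + 1)) : ℝ) ≠ 0 := by
    exact_mod_cast Fintype.card_ne_zero
  have hcard' : Fintype.card ((algorithm k prog).Draws X Y N) =
      Fintype.card (Fin prog.length → Y ⊕ X → Fin (2 * N.factorial - 1 + 1)) :=
    Fintype.card_congr (Equiv.piComm _)
  have hcount : (Fintype.card {ω : (algorithm k prog).Draws X Y N //
      ∃ M, P.IsAlmostStable ε M ∧ (algorithm k prog).Outputs P ident N ω M} : ℝ) =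
      ∑ ω : Fin prog.length → Y ⊕ X → Fin (2 * N.factorial - 1 + 1),
        (1 - f (gexec k P ident N prog (ginit P ident N) (extend ω))) := by
    rw [Fintype.card_subtype, Finset.card_eq_sum_ones, Finset.sum_filter, Nat.cast_sum]
    refine Fintype.sum_equiv (Equiv.piComm _) _ _ fun ω => ?_
    have ho : ∀ M, (algorithm k prog).Outputs P ident N ω M ↔
      (∀ m i, (gexec k P ident N prog (ginit P ident N)
          (extend fun s u => ω u s) (Sum.inl m)).partner = some i ↔
        ∃ w, (m, w) ∈ M ∧ ident (Sum.inr w) = i) ∧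
      (∀ w i, (gexec k P ident N prog (ginit P ident N)
          (extend fun s u => ω u s) (Sum.inr w)).partner = some i ↔
        ∃ m, (m, w) ∈ M ∧ ident (Sum.inl m) = i) := by
      intro M
      simp only [Outputs, run_algorithm]
      have : prog.take (algorithm k prog).rounds = prog := List.take_length
      rw [this]
    simp only [ho]
    by_cases hM : C (gexec k P ident N prog (ginit P ident N) (extend fun s u => ω u s))
    · have hf1 : f (gexec k P ident N prog (ginit P ident N)
          (extend ((Equiv.piComm _) ω))) = 0 := if_pos hM
      rw [hf1, if_pos hM]
      simp
    · have hf1 : f (gexec k P ident N prog (ginit P ident N)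
          (extend ((Equiv.piComm _) ω))) = 1 := if_neg hM
      rw [hf1, if_neg hM]
      simp
  rw [successProbability, hcount, hcard', Finset.sum_sub_distrib, hs, sub_div,
    mul_div_cancel_right₀ _ hcard]
  congr 1
  simp only [Finset.sum_const, Finset.card_univ, nsmul_eq_mul, mul_one]
  exact div_self hcard

variable {k P ident N}

/-- An instruction that uses no random number contributes a deterministic step. -/
theorem expect_cons_of_forall {R : ℕ} (hR : 0 < R) {i : Instr} {σ : Y ⊕ X → Loc}
    (h : ∀ r, gstep k P ident N i σ r = gstep k P ident N i σ fun _ => 0) (p : List Instr)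
    (f : (Y ⊕ X → Loc) → ℝ) :
    expect k P ident N R (i :: p) σ f =
      expect k P ident N R p (gstep k P ident N i σ fun _ => 0) f := by
  have : NeZero R := ⟨hR.ne'⟩
  have hc : (Fintype.card (Y ⊕ X → Fin R) : ℝ) ≠ 0 := by
    exact_mod_cast Fintype.card_ne_zero
  rw [expect, Finset.sum_congr rfl fun r _ => by rw [h fun v => r v], Finset.sum_const,
    Finset.card_univ, nsmul_eq_mul]
  field_simp

end Expectation

end Execution

/-! ### Quantile matching as a process on sets of edges -/

section Core

variable {X Y : Type*} [DecidableEq X] [DecidableEq Y]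

/-- A set of edges, no two of which share a vertex. -/
def Disj (M : Finset (Y × X)) : Prop :=
  ∀ e ∈ M, ∀ f ∈ M, e.1 = f.1 ∨ e.2 = f.2 → e = f

/-- The global state: the current matching, the edges not yet rejected, the edges along which the
men propose in the current call, the residual graph of the maximal matching procedure. -/
structure Core (X Y : Type*) where
  M : Finset (Y × X)
  live : Finset (Y × X)
  act : Finset (Y × X)
  res : Finset (Y × X)

namespace Core

variable (qm qw : Y × X → ℕ) (E : Finset (Y × X))

/-- The state before the first round. -/
def start : Core X Y where
  M := ∅
  live := E
  act := ∅
  res := ∅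

/-- Every unmatched man chooses the women in his best nonempty quantile. -/
def reset (G : Core X Y) : Core X Y where
  M := G.M
  live := G.live
  act := G.live.filter fun e =>
    (∀ f ∈ G.M, f.1 ≠ e.1) ∧ ∀ f ∈ G.live, f.1 = e.1 → qm e ≤ qm f
  res := G.res

/-- Every woman accepts the proposals of quantile `i`. -/
def offer (i : ℕ) (G : Core X Y) : Core X Y where
  M := G.M
  live := G.live
  act := G.act
  res := (G.act ∩ G.live).filter fun e => qw e = i

/-- The matching after the edges of `μ` have been added. -/
def newM (μ : Finset (Y × X)) (G : Core X Y) : Finset (Y × X) :=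
  (G.M.filter fun e => ∀ f ∈ μ, f.2 ≠ e.2) ∪ μ

/-- The edges of `μ` are added to the matching, and women reject men who are not in a better
quantile than their partner. -/
def iter (μ : Finset (Y × X)) (G : Core X Y) : Core X Y where
  M := G.newM μ
  live := G.live.filter fun e => ∀ f ∈ G.newM μ, f.2 = e.2 → f ≠ e → qw e < qw f
  act := G.act.filter fun e => ∀ f ∈ μ, f.1 ≠ e.1
  res := G.res.filter fun e => ∀ f ∈ μ, f.1 ≠ e.1 ∧ f.2 ≠ e.2

/-- The residual edges are deleted. -/
def clean (G : Core X Y) : Core X Y where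
  M := G.M
  live := G.live \ G.res
  act := G.act
  res := ∅

/-- The invariants of the process. -/
structure Inv (G : Core X Y) : Prop where
  live_sub : G.live ⊆ E
  sub_live : G.M ⊆ G.live
  res_sub : G.res ⊆ G.act ∩ G.live
  disj : Disj G.M
  -- Because of this, every change of partner gains a woman at least one quantile.
  better : ∀ e ∈ G.live, ∀ f ∈ G.M, f.2 = e.2 → f ≠ e → qw e < qw f
  -- A live edge that a matched man prefers to his partner must therefore lie in the partner's
  -- quantile.
  minimal : ∀ f ∈ G.M, ∀ e ∈ G.live, f.1 = e.1 → qm f ≤ qm e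
  act_free : ∀ e ∈ G.act, ∀ f ∈ G.M, f.1 ≠ e.1
  act_min : ∀ a ∈ G.act, ∀ e ∈ G.live, e.1 = a.1 → qm a ≤ qm e
  -- Once no proposal of an active man is live, his whole quantile is exhausted.
  act_max : ∀ a ∈ G.act, ∀ e ∈ G.live, e.1 = a.1 → qm e ≤ qm a → e ∈ G.act
  res_level : ∀ e ∈ G.res, ∀ f ∈ G.res, e.2 = f.2 → qw e = qw f

variable {qm qw E} {G G₀ : Core X Y} {μ : Finset (Y × X)} {i : ℕ}

theorem inv_start : (start E).Inv qm qw E := by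
  constructor <;> simp [start, Disj]

theorem Inv.reset (h : G.Inv qm qw E) (hr : G.res = ∅) : (G.reset qm).Inv qm qw E where
  live_sub := h.live_sub
  sub_live := h.sub_live
  res_sub := by simp [Core.reset, hr]
  disj := h.disj
  better := h.better
  minimal := h.minimal
  act_free := by
    intro e he f hf
    exact (Finset.mem_filter.1 he).2.1 f hf
  act_min := by
    intro a ha e he hea
    exact (Finset.mem_filter.1 ha).2.2 e he hea
  act_max := by
    intro a ha e he hea hq
    have ha' := (Finset.mem_filter.1 ha).2
    refine Finset.mem_filter.2 ⟨he, fun f hf => ?_, fun f hf hfe => ?_⟩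
    · rw [hea]; exact ha'.1 f hf
    · exact hq.trans (ha'.2 f hf (hfe.trans hea))
  res_level := by simp [Core.reset, hr]

theorem Inv.offer (h : G.Inv qm qw E) : (G.offer qw i).Inv qm qw E where
  live_sub := h.live_sub
  sub_live := h.sub_live
  res_sub := Finset.filter_subset _ _
  disj := h.disj
  better := h.better
  minimal := h.minimal
  act_free := h.act_free
  act_min := h.act_min
  act_max := h.act_max
  res_level := by
    intro e he f hf _
    rw [(Finset.mem_filter.1 he).2, (Finset.mem_filter.1 hf).2]

theorem Inv.clean (h : G.Inv qm qw E) : G.clean.Inv qm qw E where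
  live_sub := Finset.sdiff_subset.trans h.live_sub
  -- Residual edges belong to active, hence unmatched, men, so the cleanup deletes no matched edge.
  sub_live := by
    intro e he
    refine Finset.mem_sdiff.2 ⟨h.sub_live he, fun hr => ?_⟩
    exact h.act_free e (Finset.mem_inter.1 (h.res_sub hr)).1 e he rfl
  res_sub := by simp [Core.clean]
  disj := h.disj
  better := fun e he => h.better e (Finset.mem_sdiff.1 he).1
  minimal := fun f hf e he => h.minimal f hf e (Finset.mem_sdiff.1 he).1
  act_free := h.act_free
  act_min := fun a ha e he => h.act_min a ha e (Finset.mem_sdiff.1 he).1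
  act_max := fun a ha e he => h.act_max a ha e (Finset.mem_sdiff.1 he).1
  res_level := by simp [Core.clean]

/-- The new edges are not worse for the women. -/
theorem Inv.lt_of_mem (h : G.Inv qm qw E) (hμ : μ ⊆ G.res) {e f : Y × X} (he : e ∈ μ)
    (hf : f ∈ G.M) (hfe : f.2 = e.2) : qw e < qw f := by
  have hr := Finset.mem_inter.1 (h.res_sub (hμ he))
  refine h.better e hr.2 f hf hfe ?_
  rintro rfl
  exact h.act_free f hr.1 f hf rfl

omit [DecidableEq X] in
theorem mem_reset_act {e : Y × X} : e ∈ (G.reset qm).act ↔ e ∈ G.live ∧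
    (∀ f ∈ G.M, f.1 ≠ e.1) ∧ ∀ f ∈ G.live, f.1 = e.1 → qm e ≤ qm f :=
  Finset.mem_filter

theorem mem_iter_live {e : Y × X} : e ∈ (G.iter qw μ).live ↔ e ∈ G.live ∧
    ∀ f ∈ G.newM μ, f.2 = e.2 → f ≠ e → qw e < qw f :=
  Finset.mem_filter

theorem mem_iter_act {e : Y × X} :
    e ∈ (G.iter qw μ).act ↔ e ∈ G.act ∧ ∀ f ∈ μ, f.1 ≠ e.1 :=
  Finset.mem_filter

theorem mem_iter_res {e : Y × X} :
    e ∈ (G.iter qw μ).res ↔ e ∈ G.res ∧ ∀ f ∈ μ, f.1 ≠ e.1 ∧ f.2 ≠ e.2 :=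
  Finset.mem_filter

theorem mem_offer_res {e : Y × X} :
    e ∈ (G.offer qw i).res ↔ (e ∈ G.act ∧ e ∈ G.live) ∧ qw e = i := by
  simp [offer]

theorem mem_newM {e : Y × X} :
    e ∈ G.newM μ ↔ (e ∈ G.M ∧ ∀ f ∈ μ, f.2 ≠ e.2) ∨ e ∈ μ := by
  simp [newM]

/-- New edges start at active, hence unmatched, men and displace the old partners of their women, so
the result is again a matching. The refusal rule that cuts down `live` is precisely the invariant
`better`. -/
theorem Inv.iter (h : G.Inv qm qw E) (hμ : μ ⊆ G.res) (hd : Disj μ) :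
    (G.iter qw μ).Inv qm qw E := by
  have hact : ∀ e ∈ μ, e ∈ G.act := fun e he => (Finset.mem_inter.1 (h.res_sub (hμ he))).1
  have hlive : ∀ e ∈ μ, e ∈ G.live := fun e he => (Finset.mem_inter.1 (h.res_sub (hμ he))).2
  have hdisj : Disj (G.newM μ) := by
    intro e he f hf hef
    rw [mem_newM] at he hf
    rcases he with ⟨he, he'⟩ | he <;> rcases hf with ⟨hf, hf'⟩ | hf
    · exact h.disj e he f hf hef
    · rcases hef with hef | hef
      · exact absurd hef (h.act_free f (hact f hf) e he)
      · exact absurd hef.symm (he' f hf)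
    · rcases hef with hef | hef
      · exact absurd hef.symm (h.act_free e (hact e he) f hf)
      · exact absurd hef (hf' e he)
    · exact hd e he f hf hef
  have hMl : G.newM μ ⊆ G.live := by
    intro e he
    rcases mem_newM.1 he with ⟨he, _⟩ | he
    · exact h.sub_live he
    · exact hlive e he
  constructor
  · exact (Finset.filter_subset _ _).trans h.live_sub
  · intro e he
    refine Finset.mem_filter.2 ⟨hMl he, fun f hf hfe hne => ?_⟩
    exact absurd (hdisj f hf e he (Or.inr hfe)) hne
  · intro e he
    have he' := Finset.mem_filter.1 he
    have hr := Finset.mem_inter.1 (h.res_sub he'.1)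
    refine Finset.mem_inter.2 ⟨Finset.mem_filter.2 ⟨hr.1, fun f hf => (he'.2 f hf).1⟩,
      Finset.mem_filter.2 ⟨hr.2, fun f hf hfe hne => ?_⟩⟩
    rcases mem_newM.1 hf with ⟨hf, _⟩ | hf
    · exact h.better e hr.2 f hf hfe hne
    · exact absurd hfe (he'.2 f hf).2
  · exact hdisj
  · intro e he f hf
    exact (Finset.mem_filter.1 he).2 f hf
  · intro f hf e he hfe
    have he' := (Finset.mem_filter.1 he).1
    rcases mem_newM.1 hf with ⟨hf, _⟩ | hf
    · exact h.minimal f hf e he' hfe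
    · exact h.act_min f (hact f hf) e he' hfe.symm
  · intro e he f hf
    have he' := Finset.mem_filter.1 he
    rcases mem_newM.1 hf with ⟨hf, _⟩ | hf
    · exact h.act_free e he'.1 f hf
    · exact he'.2 f hf
  · intro a ha e he
    exact h.act_min a (Finset.mem_filter.1 ha).1 e (Finset.mem_filter.1 he).1
  · intro a ha e he hea hq
    have ha' := Finset.mem_filter.1 ha
    refine Finset.mem_filter.2
      ⟨h.act_max a ha'.1 e (Finset.mem_filter.1 he).1 hea hq, fun f hf => ?_⟩
    rw [hea]
    exact ha'.2 f hf
  · intro e he f hf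
    exact h.res_level e (Finset.mem_filter.1 he).1 f (Finset.mem_filter.1 hf).1

/-- The matched edges after an iteration improve on those before. -/
theorem Inv.exists_newM (h : G.Inv qm qw E) (hμ : μ ⊆ G.res) {f : Y × X} (hf : f ∈ G.M) :
    ∃ g ∈ G.newM μ, g.2 = f.2 ∧ qw g ≤ qw f := by
  by_cases hc : ∀ g ∈ μ, g.2 ≠ f.2
  · exact ⟨f, mem_newM.2 (Or.inl ⟨hf, hc⟩), rfl, le_rfl⟩
  · push Not at hc
    obtain ⟨g, hg, hgf⟩ := hc
    exact ⟨g, mem_newM.2 (Or.inr hg), hgf, (h.lt_of_mem hμ hg hf hgf.symm).le⟩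

/-! #### Edges that were deleted without reason -/

variable (qw E) in
/-- The deleted edges whose woman would prefer the man to her partner. -/
def lost (G : Core X Y) : Finset (Y × X) :=
  (E \ G.live).filter fun e => ∀ f ∈ G.M, f.2 = e.2 → qw e < qw f

theorem mem_lost {e : Y × X} :
    e ∈ G.lost qw E ↔ (e ∈ E ∧ e ∉ G.live) ∧ ∀ f ∈ G.M, f.2 = e.2 → qw e < qw f := by
  simp [lost]

theorem lost_start : (start E).lost qw E = ∅ := by
  simp [lost, start]

/-- A refused edge is not lost, since its woman has a partner in a quantile at least as good; and an
earlier justified deletion stays justified, since partners of women never get worse. Lost edges thus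
arise only in `clean`. -/
theorem Inv.lost_iter (h : G.Inv qm qw E) (hμ : μ ⊆ G.res) :
    (G.iter qw μ).lost qw E ⊆ G.lost qw E := by
  intro e he
  simp only [lost, Finset.mem_filter, Finset.mem_sdiff] at he ⊢
  obtain ⟨⟨heE, hel⟩, hef⟩ := he
  refine ⟨⟨heE, fun hl => ?_⟩, fun f hf hfe => ?_⟩
  · refine hel (Finset.mem_filter.2 ⟨hl, fun f hf hfe _ => ?_⟩)
    exact hef f hf hfe
  · obtain ⟨g, hg, hgf, hgq⟩ := h.exists_newM hμ hf
    exact (hef g hg (hgf.trans hfe)).trans_le hgq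

theorem lost_clean : (G.clean).lost qw E ⊆ G.lost qw E ∪ G.res := by
  intro e he
  have he' := mem_lost.1 he
  by_cases hr : e ∈ G.res
  · exact Finset.mem_union_right _ hr
  · exact Finset.mem_union_left _ (mem_lost.2
      ⟨⟨he'.1.1, fun hl => he'.1.2 (Finset.mem_sdiff.2 ⟨hl, hr⟩)⟩, he'.2⟩)

/-! #### The potential -/

variable [Fintype X] [Fintype Y]

variable (qw) in
/-- The potential of the women: the number of quantiles better than that of the partner. -/
def potW (k : ℕ) (G : Core X Y) : ℕ :=
  ∑ w : X, ((Finset.range k).filter fun c => ∀ f ∈ G.M, f.2 = w → c < qw f).card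

variable (qm) in
/-- The potential of the men: the number of quantiles that have not been exhausted. -/
def potM (G : Core X Y) : ℕ :=
  ∑ m : Y, ((G.live.filter fun e => e.1 = m).image qm).card

/-- The men who propose in the current call. -/
def active (G : Core X Y) : Finset Y := G.act.image Prod.fst

/-- The unmatched men who have not been rejected by all women. -/
def bad (G : Core X Y) : Finset Y :=
  Finset.univ.filter fun m => (∀ f ∈ G.M, f.1 ≠ m) ∧ ∃ e ∈ G.live, e.1 = m

theorem potW_le (k : ℕ) : G.potW qw k ≤ Fintype.card X * k := by
  refine (Finset.sum_le_card_nsmul _ _ k fun w _ => ?_).trans_eq (by simp)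
  exact (Finset.card_filter_le _ _).trans_eq (Finset.card_range k)

omit [DecidableEq X] [Fintype X] in
theorem potM_le {k : ℕ} (hq : ∀ e ∈ G.live, qm e < k) : G.potM qm ≤ Fintype.card Y * k := by
  refine (Finset.sum_le_card_nsmul _ _ k fun w _ => ?_).trans_eq (by simp)
  refine (Finset.card_le_card (t := Finset.range k) fun c hc => ?_).trans_eq
    (Finset.card_range k)
  obtain ⟨e, he, rfl⟩ := Finset.mem_image.1 hc
  exact Finset.mem_range.2 (hq e (Finset.mem_filter.1 he).1)

/-- A man stops being active only through an edge `e` of `μ`, and then the value `qw e` drops out of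
the count of its woman. Distinct edges of `μ` have distinct women, so `potW` pays for every man who
stops being active. -/
theorem Inv.pot_iter (h : G.Inv qm qw E) {k : ℕ} (hq : ∀ e ∈ E, qw e < k) (hμ : μ ⊆ G.res)
    (hd : Disj μ) :
    (G.iter qw μ).potW qw k + G.active.card ≤ G.potW qw k + (G.iter qw μ).active.card := by
  have h1 : G.active ⊆ (G.iter qw μ).active ∪ μ.image Prod.fst := by
    intro m hm
    obtain ⟨e, he, rfl⟩ := Finset.mem_image.1 hm
    by_cases hc : ∀ f ∈ μ, f.1 ≠ e.1
    · exact Finset.mem_union_left _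
        (Finset.mem_image_of_mem _ (mem_iter_act.2 ⟨he, hc⟩))
    · push Not at hc
      obtain ⟨f, hf, hfe⟩ := hc
      exact Finset.mem_union_right _ (Finset.mem_image.2 ⟨f, hf, hfe⟩)
  have h2 : G.active.card ≤ (G.iter qw μ).active.card + μ.card :=
    (Finset.card_le_card h1).trans ((Finset.card_union_le _ _).trans
      (Nat.add_le_add_left Finset.card_image_le _))
  have h3 : (μ.image Prod.snd).card = μ.card :=
    Finset.card_image_of_injOn fun e he f hf hef => hd e he f hf (Or.inr hef)
  have h4 : (G.iter qw μ).potW qw k + (μ.image Prod.snd).card ≤ G.potW qw k := by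
    have h5 : (μ.image Prod.snd).card =
        ∑ w : X, if w ∈ μ.image Prod.snd then 1 else 0 := by
      rw [Finset.sum_ite_mem, Finset.univ_inter, Finset.card_eq_sum_ones]
    rw [h5, potW, potW, ← Finset.sum_add_distrib]
    refine Finset.sum_le_sum fun w _ => ?_
    have hsub : ((Finset.range k).filter fun c =>
        ∀ f ∈ (G.iter qw μ).M, f.2 = w → c < qw f) ⊆
        (Finset.range k).filter fun c => ∀ f ∈ G.M, f.2 = w → c < qw f := by
      intro c hc
      rw [Finset.mem_filter] at hc ⊢
      refine ⟨hc.1, fun f hf hfw => ?_⟩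
      obtain ⟨g, hg, hgf, hgq⟩ := h.exists_newM hμ hf
      exact (hc.2 g hg (hgf.trans hfw)).trans_le hgq
    split_ifs with hw
    · obtain ⟨e, he, rfl⟩ := Finset.mem_image.1 hw
      refine Finset.card_lt_card ((Finset.ssubset_iff_of_subset hsub).2 ⟨qw e, ?_, ?_⟩)
      · have heE : e ∈ E := h.live_sub (Finset.mem_inter.1 (h.res_sub (hμ he))).2
        exact Finset.mem_filter.2 ⟨Finset.mem_range.2 (hq e heE), fun f hf hfe =>
          h.lt_of_mem hμ he hf hfe⟩
      · intro hc
        exact lt_irrefl _ ((Finset.mem_filter.1 hc).2 e (mem_newM.2 (Or.inr he)) rfl)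
    · simpa using Finset.card_le_card hsub
  omega

theorem active_reset : (G.reset qm).active = G.bad := by
  ext m
  simp only [active, bad, Finset.mem_image, Finset.mem_filter, Finset.mem_univ, true_and]
  constructor
  · rintro ⟨e, he, rfl⟩
    have he' := mem_reset_act.1 he
    exact ⟨he'.2.1, e, he'.1, rfl⟩
  · rintro ⟨h1, e, he, hem⟩
    obtain ⟨f, hf, hfm⟩ := Finset.exists_min_image (G.live.filter fun e => e.1 = m) qm
      ⟨e, Finset.mem_filter.2 ⟨he, hem⟩⟩
    rw [Finset.mem_filter] at hf
    refine ⟨f, mem_reset_act.2 ⟨hf.1, fun g hg => ?_, fun g hg hgf => ?_⟩, hf.2⟩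
    · rw [hf.2]; exact h1 g hg
    · exact hfm g (Finset.mem_filter.2 ⟨hg, hgf.trans hf.2⟩)

/-- The men split into bad ones, matched ones and those without live edges; the last two classes are
disjoint because matched edges are live. -/
theorem Inv.card_bad (h : G.Inv qm qw E) :
    G.bad.card + G.M.card +
      (Finset.univ.filter fun m : Y => ∀ e ∈ G.live, e.1 ≠ m).card = Fintype.card Y := by
  have h1 : (G.M.image Prod.fst).card = G.M.card :=
    Finset.card_image_of_injOn fun e he f hf hef => h.disj e he f hf (Or.inl hef)
  rw [← h1, ← Finset.card_union_of_disjoint, ← Finset.card_union_of_disjoint,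
    ← Finset.card_univ]
  · congr 1
    ext m
    simp only [bad, Finset.mem_union, Finset.mem_filter, Finset.mem_univ, true_and,
      Finset.mem_image, iff_true]
    by_cases hl : ∀ e ∈ G.live, e.1 ≠ m
    · exact Or.inr hl
    · refine Or.inl ?_
      push Not at hl
      by_cases hm : ∀ f ∈ G.M, f.1 ≠ m
      · exact Or.inl ⟨hm, hl⟩
      · push Not at hm
        exact Or.inr hm
  · rw [Finset.disjoint_left]
    intro m hm hm'
    have hl := (Finset.mem_filter.1 hm').2
    rcases Finset.mem_union.1 hm with hm | hm
    · obtain ⟨e, he, hem⟩ := (Finset.mem_filter.1 hm).2.2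
      exact hl e he hem
    · obtain ⟨e, he, hem⟩ := Finset.mem_image.1 hm
      exact hl e (h.sub_live he) hem
  · rw [Finset.disjoint_left]
    intro m hm hm'
    obtain ⟨e, he, hem⟩ := Finset.mem_image.1 hm'
    exact (Finset.mem_filter.1 hm).2.1 e he hem

/-! #### A call of the quantile matching -/

variable (qw) in
/-- What is known about a state during the call that began in the state `G₀`. -/
structure Call (k : ℕ) (G₀ G : Core X Y) : Prop where
  act_sub : G.act ⊆ G₀.live
  live_sub : G.live ⊆ G₀.live
  matched : ∀ f ∈ G₀.M, ∃ g ∈ G.M, g.2 = f.2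
  pot : G.potW qw k + G₀.bad.card ≤ G₀.potW qw k + G.active.card

theorem call_reset (k : ℕ) : Call qw k G (G.reset qm) where
  act_sub := fun _ he => (mem_reset_act.1 he).1
  live_sub := subset_rfl
  matched := fun f hf => ⟨f, hf, rfl⟩
  pot := by rw [active_reset]; exact le_rfl

theorem Call.offer {k : ℕ} (h : Call qw k G₀ G) : Call qw k G₀ (G.offer qw i) :=
  ⟨h.act_sub, h.live_sub, h.matched, h.pot⟩

theorem Call.clean {k : ℕ} (h : Call qw k G₀ G) : Call qw k G₀ G.clean :=
  ⟨h.act_sub, Finset.sdiff_subset.trans h.live_sub, h.matched, h.pot⟩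

theorem Call.iter {k : ℕ} (h : Call qw k G₀ G) (hG : G.Inv qm qw E) (hq : ∀ e ∈ E, qw e < k)
    (hμ : μ ⊆ G.res) (hd : Disj μ) : Call qw k G₀ (G.iter qw μ) where
  act_sub := fun _ he => h.act_sub (mem_iter_act.1 he).1
  live_sub := fun _ he => h.live_sub (mem_iter_live.1 he).1
  matched := by
    intro f hf
    obtain ⟨g, hg, hgf⟩ := h.matched f hf
    obtain ⟨g', hg', hgg, _⟩ := hG.exists_newM hμ hg
    exact ⟨g', hg', hgg.trans hgf⟩
  pot := by
    have h1 := hG.pot_iter hq hμ hd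
    have h2 := h.pot
    omega

/-- The number of bad men does not increase in a call. -/
theorem Call.card_bad_le {k : ℕ} (h : Call qw k G₀ G) (hG₀ : G₀.Inv qm qw E)
    (hG : G.Inv qm qw E) : G.bad.card ≤ G₀.bad.card := by
  have h1 := hG₀.card_bad
  have h2 := hG.card_bad
  -- The two classes complementary to the bad men can only grow: live edges are never restored, and
  -- a matched woman stays matched.
  have h3 : (Finset.univ.filter fun m : Y => ∀ e ∈ G₀.live, e.1 ≠ m).card ≤
      (Finset.univ.filter fun m : Y => ∀ e ∈ G.live, e.1 ≠ m).card :=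
    Finset.card_le_card (Finset.monotone_filter_right _ fun m _ hm e he => hm e (h.live_sub he))
  have h4 : G₀.M.card ≤ G.M.card := by
    rw [← Finset.card_image_of_injOn (s := G₀.M) (f := Prod.snd)
        fun e he f hf hef => hG₀.disj e he f hf (Or.inr hef),
      ← Finset.card_image_of_injOn (s := G.M) (f := Prod.snd)
        fun e he f hf hef => hG.disj e he f hf (Or.inr hef)]
    refine Finset.card_le_card fun w hw => ?_
    obtain ⟨f, hf, rfl⟩ := Finset.mem_image.1 hw
    obtain ⟨g, hg, hgf⟩ := h.matched f hf
    exact Finset.mem_image.2 ⟨g, hg, hgf⟩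
  omega

/-- If all proposals have been answered, then the potential has decreased by the number of men
who were bad at the beginning of the call. -/
theorem Call.pot_le {k : ℕ} (h : Call qw k G₀ G) (hG : G.Inv qm qw E)
    (hdone : G.act ∩ G.live = ∅) :
    G₀.bad.card + (G.potW qw k + G.potM qm) ≤ G₀.potW qw k + G₀.potM qm := by
  -- By `act_max` and `hdone`, a man who is still active has no live edge left in the quantile he
  -- proposed to, so this quantile drops out of his image.
  have h1 : G.potM qm + G.active.card ≤ G₀.potM qm := by
    have h5 : G.active.card = ∑ m : Y, if m ∈ G.active then 1 else 0 := by
      simp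
    rw [h5, potM, potM, ← Finset.sum_add_distrib]
    refine Finset.sum_le_sum fun m _ => ?_
    have hsub : ((G.live.filter fun e => e.1 = m).image qm) ⊆
        (G₀.live.filter fun e => e.1 = m).image qm :=
      Finset.image_subset_image (Finset.filter_subset_filter _ h.live_sub)
    split_ifs with hm
    · obtain ⟨e, he, rfl⟩ := Finset.mem_image.1 hm
      refine Finset.card_lt_card ((Finset.ssubset_iff_of_subset hsub).2 ⟨qm e, ?_, ?_⟩)
      · exact Finset.mem_image_of_mem _ (Finset.mem_filter.2 ⟨h.act_sub he, rfl⟩)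
      · intro hc
        obtain ⟨f, hf, hfe⟩ := Finset.mem_image.1 hc
        rw [Finset.mem_filter] at hf
        have := Finset.mem_inter.2 ⟨hG.act_max e he f hf.1 hf.2 hfe.le, hf.1⟩
        rw [hdone] at this
        exact absurd this (Finset.notMem_empty _)
    · simpa using Finset.card_le_card hsub
  have h2 := h.pot
  omega

/-! #### Blocking pairs -/

/-- Every blocking pair belongs to a bad man, or lies in the quantile of a partner of one of its
members, or is lost. -/
theorem Inv.blocking_subset (h : G.Inv qm qw E) {rm rw : Y × X → ℕ}
    (hm : ∀ e f, e.1 = f.1 → rm e < rm f → qm e ≤ qm f)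
    (hw : ∀ e f, e.2 = f.2 → rw e < rw f → qw e ≤ qw f) {e : Y × X} (heE : e ∈ E)
    (h1 : ∀ f ∈ G.M, f.1 = e.1 → rm e < rm f)
    (h2 : ∀ f ∈ G.M, f.2 = e.2 → rw e < rw f) :
    e.1 ∈ G.bad ∨ (∃ f ∈ G.M, f.1 = e.1 ∧ rm e < rm f ∧ qm e = qm f) ∨
      (∃ f ∈ G.M, f.2 = e.2 ∧ rw e < rw f ∧ qw e = qw f) ∨ e ∈ G.lost qw E := by
  -- For a live edge of a matched man, `minimal` and the man's preference give opposite
  -- inequalities, so the quantiles agree. For a deleted edge that is not lost, the same squeeze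
  -- works on the woman's side.
  by_cases hl : e ∈ G.live
  · by_cases hu : ∀ f ∈ G.M, f.1 ≠ e.1
    · exact Or.inl (Finset.mem_filter.2 ⟨Finset.mem_univ _, hu, e, hl, rfl⟩)
    · push Not at hu
      obtain ⟨f, hf, hfe⟩ := hu
      exact Or.inr (Or.inl ⟨f, hf, hfe, h1 f hf hfe,
        le_antisymm (hm e f hfe.symm (h1 f hf hfe)) (h.minimal f hf e hl hfe)⟩)
  · by_cases hp : ∀ f ∈ G.M, f.2 = e.2 → qw e < qw f
    · exact Or.inr (Or.inr (Or.inr (mem_lost.2 ⟨⟨heE, hl⟩, hp⟩)))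
    · push Not at hp
      obtain ⟨f, hf, hfe, hq⟩ := hp
      exact Or.inr (Or.inr (Or.inl ⟨f, hf, hfe, h2 f hf hfe,
        le_antisymm (hw e f hfe.symm (h2 f hf hfe)) hq⟩))

/-! #### Levels -/

variable (qw) in
/-- The pending proposals are of quantile greater than `i`, or are residual and of quantile `i`. -/
def Level (i : ℕ) (G : Core X Y) : Prop :=
  ∀ e ∈ G.act ∩ G.live, i < qw e ∨ qw e = i ∧ e ∈ G.res

variable (qw) in
/-- The pending proposals are of quantile at least `i`. -/
def Above (i : ℕ) (G : Core X Y) : Prop := ∀ e ∈ G.act ∩ G.live, i ≤ qw e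

-- `Above` and `Level` alternate through the proposal rounds of a call. The last round reaches
-- `Above` at `k`, which means that no proposal is pending.
omit [Fintype X] [Fintype Y] in
theorem Above.offer (h : Above qw i G) : Level qw i (G.offer qw i) := by
  intro e he
  rcases (h e he).lt_or_eq with hlt | heq
  · exact Or.inl hlt
  · exact Or.inr ⟨heq.symm, Finset.mem_filter.2 ⟨he, heq.symm⟩⟩

omit [Fintype X] [Fintype Y] in
theorem Level.clean (h : Level qw i G) : Above qw (i + 1) G.clean := by
  intro e he
  have he' := Finset.mem_inter.1 he
  have hl := Finset.mem_sdiff.1 he'.2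
  rcases h e (Finset.mem_inter.2 ⟨he'.1, hl.1⟩) with hlt | heq
  · exact hlt
  · exact absurd heq.2 hl.2

-- A residual edge leaves the residual graph because its man or its woman gets matched. He is then
-- no longer active, and she refuses the edge because all her residual edges lie in one quantile;
-- either way it is not pending.
omit [Fintype X] [Fintype Y] in
theorem Level.iter (h : Level qw i G) (hG : G.Inv qm qw E) (hμ : μ ⊆ G.res) :
    Level qw i (G.iter qw μ) := by
  intro e he
  obtain ⟨hea, hel⟩ := Finset.mem_inter.1 he
  obtain ⟨hea, hem⟩ := Finset.mem_filter.1 hea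
  obtain ⟨hel, hew⟩ := Finset.mem_filter.1 hel
  refine (h e (Finset.mem_inter.2 ⟨hea, hel⟩)).imp_right fun ⟨hq, hr⟩ =>
    ⟨hq, Finset.mem_filter.2 ⟨hr, fun f hf => ⟨hem f hf, fun hfe => ?_⟩⟩⟩
  have h1 := hew f (mem_newM.2 (Or.inr hf)) hfe fun hfe' => hem f hf (by rw [hfe'])
  rw [hG.res_level e hr f (hμ hf) hfe.symm] at h1
  exact lt_irrefl _ h1

end Core

end Core

/-! ### The algorithm realizes the process -/

theorem idxOf_map_of_injective {ι κ : Type*} [DecidableEq ι] [DecidableEq κ] {f : ι → κ}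
    (hf : Function.Injective f) (l : List ι) (a : ι) : (l.map f).idxOf (f a) = l.idxOf a := by
  induction l with
  | nil => rfl
  | cons b l ih => simp [List.idxOf_cons, ih, hf.beq_eq]

theorem quantile_map {ι κ : Type*} [DecidableEq ι] [DecidableEq κ] {f : ι → κ}
    (hf : Function.Injective f) (k : ℕ) (l : List ι) (a : ι) :
    quantile k (l.map f) (f a) = quantile k l a := by
  simp [quantile, idxOf_map_of_injective hf]

section Rep

variable {X Y : Type*} [DecidableEq X] [DecidableEq Y]

/-- The quantile of an edge on the list of its man. -/
def quantM (k : ℕ) (P : Preferences X Y) (e : Y × X) : ℕ := quantile k (P.ofMan e.1) e.2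

/-- The quantile of an edge on the list of its woman. -/
def quantW (k : ℕ) (P : Preferences X Y) (e : Y × X) : ℕ := quantile k (P.ofWoman e.2) e.1

/-- The states of the processors represent the global state `G`. -/
structure Rep (ident : Y ⊕ X → ℕ) (σ : Y ⊕ X → Loc) (G : Core X Y) : Prop where
  live : ∀ m i, i ∈ (σ (Sum.inl m)).live ↔ ∃ w, (m, w) ∈ G.live ∧ ident (Sum.inr w) = i
  act : ∀ m i, i ∈ (σ (Sum.inl m)).act ↔ ∃ w, (m, w) ∈ G.act ∧ ident (Sum.inr w) = i
  resM : ∀ m i, i ∈ (σ (Sum.inl m)).resid ↔ ∃ w, (m, w) ∈ G.res ∧ ident (Sum.inr w) = i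
  resW : ∀ w i, i ∈ (σ (Sum.inr w)).resid ↔ ∃ m, (m, w) ∈ G.res ∧ ident (Sum.inl m) = i
  partnerM : ∀ m i, (σ (Sum.inl m)).partner = some i ↔
    ∃ w, (m, w) ∈ G.M ∧ ident (Sum.inr w) = i
  partnerW : ∀ w i, (σ (Sum.inr w)).partner = some i ↔
    ∃ m, (m, w) ∈ G.M ∧ ident (Sum.inl m) = i

variable {k : ℕ} {P : Preferences X Y} {ident : Y ⊕ X → ℕ} {N : ℕ}
  {σ : Y ⊕ X → Loc} {G : Core X Y} {E : Finset (Y × X)}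

section Ident

variable (hi : Function.Injective ident)

include hi

omit [DecidableEq X] [DecidableEq Y] in
theorem exists_woman_iff {p : X → Prop} (w : X) :
    (∃ w', p w' ∧ ident (Sum.inr w') = ident (Sum.inr w)) ↔ p w := by
  constructor
  · rintro ⟨w', h, h'⟩
    rwa [← Sum.inr_injective (hi h')]
  · exact fun h => ⟨w, h, rfl⟩

omit [DecidableEq X] [DecidableEq Y] in
theorem exists_man_iff {p : Y → Prop} (m : Y) :
    (∃ m', p m' ∧ ident (Sum.inl m') = ident (Sum.inl m)) ↔ p m := by
  constructor
  · rintro ⟨m', h, h'⟩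
    rwa [← Sum.inl_injective (hi h')]
  · exact fun h => ⟨m, h, rfl⟩

theorem quantile_prefs_man (m : Y) (w : X) :
    quantile k (localInput P ident N (Sum.inl m)).prefs (ident (Sum.inr w)) =
      quantM k P (m, w) := by
  have h : (localInput P ident N (Sum.inl m)).prefs =
      (P.ofMan m).map fun w => ident (Sum.inr w) := by
    simp [localInput, neighbors, Function.comp_def]
  rw [h]
  exact quantile_map (f := fun w : X => ident (Sum.inr w))
    (fun _ _ h => Sum.inr_injective (hi h)) k (P.ofMan m) w

theorem quantile_prefs_woman (w : X) (m : Y) :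
    quantile k (localInput P ident N (Sum.inr w)).prefs (ident (Sum.inl m)) =
      quantW k P (m, w) := by
  have h : (localInput P ident N (Sum.inr w)).prefs =
      (P.ofWoman w).map fun m => ident (Sum.inl m) := by
    simp [localInput, neighbors, Function.comp_def]
  rw [h]
  exact quantile_map (f := fun m : Y => ident (Sum.inl m))
    (fun _ _ h => Sum.inl_injective (hi h)) k (P.ofWoman w) m

theorem find?_ident {l : List (Y ⊕ X)} {u : Y ⊕ X} (hu : u ∈ l) :
    l.find? (fun u' => ident u' == ident u) = some u := by
  cases h : l.find? (fun u' => ident u' == ident u) with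
  | none => simpa using List.find?_eq_none.1 h u hu
  | some u' =>
    have := List.find?_some h
    rw [beq_iff_eq] at this
    rw [hi this]

theorem mem_inbox {v : Y ⊕ X} {i : ℕ} :
    i ∈ inbox P ident N σ v ↔ ∃ u ∈ P.neighbors v, ident u = i ∧ ident v ∈ (σ u).out := by
  rw [inbox, senders, Finset.mem_filter, List.mem_toFinset]
  simp only [localInput, List.mem_map]
  constructor
  · rintro ⟨⟨u, hu, rfl⟩, h⟩
    refine ⟨u, hu, rfl, ?_⟩
    rw [deliver, find?_ident hi hu] at h
    by_contra hn
    simp [Loc.mail, hn] at h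
  · rintro ⟨u, hu, rfl, h⟩
    refine ⟨⟨u, hu, rfl⟩, ?_⟩
    rw [deliver, find?_ident hi hu]
    simp [Loc.mail, h]

theorem mem_inbox_man {m : Y} {i : ℕ} :
    i ∈ inbox P ident N σ (Sum.inl m) ↔
      ∃ w, (w ∈ P.ofMan m ∧ ident (Sum.inl m) ∈ (σ (Sum.inr w)).out) ∧
        ident (Sum.inr w) = i := by
  rw [mem_inbox hi]
  simp only [neighbors, List.mem_map]
  constructor
  · rintro ⟨u, ⟨w, hw, rfl⟩, h1, h2⟩
    exact ⟨w, ⟨hw, h2⟩, h1⟩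
  · rintro ⟨w, ⟨hw, h2⟩, h1⟩
    exact ⟨_, ⟨w, hw, rfl⟩, h1, h2⟩

theorem mem_inbox_woman {w : X} {i : ℕ} :
    i ∈ inbox P ident N σ (Sum.inr w) ↔
      ∃ m, (w ∈ P.ofMan m ∧ ident (Sum.inr w) ∈ (σ (Sum.inl m)).out) ∧
        ident (Sum.inl m) = i := by
  rw [mem_inbox hi]
  simp only [neighbors, List.mem_map]
  constructor
  · rintro ⟨u, ⟨m, hm, rfl⟩, h1, h2⟩
    exact ⟨m, ⟨(P.symmetric m w).1 hm, h2⟩, h1⟩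
  · rintro ⟨m, ⟨hm, h2⟩, h1⟩
    exact ⟨_, ⟨m, (P.symmetric m w).2 hm, rfl⟩, h1, h2⟩

theorem ident_mem_prefs_man {m : Y} {w : X} :
    ident (Sum.inr w) ∈ (localInput P ident N (Sum.inl m)).prefs.toFinset ↔ w ∈ P.ofMan m := by
  simp [localInput, neighbors, hi.eq_iff]

theorem ident_mem_prefs_woman {m : Y} {w : X} :
    ident (Sum.inl m) ∈ (localInput P ident N (Sum.inr w)).prefs.toFinset ↔ w ∈ P.ofMan m := by
  simp [localInput, neighbors, hi.eq_iff, P.symmetric]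

/-! #### The first rounds of a call and of a proposal round -/

theorem rep_ginit (hE : ∀ e, e ∈ E ↔ e.2 ∈ P.ofMan e.1) :
    Rep ident (ginit P ident N) (Core.start E) := by
  constructor <;> simp [ginit, Loc.init, Core.start, hE, localInput, neighbors]

theorem Rep.reset (h : Rep ident σ G) (r : Y ⊕ X → ℕ) :
    Rep ident (gstep k P ident N .reset σ r) (G.reset (quantM k P)) where
  live := h.live
  act := by
    intro m i
    have hn : (σ (Sum.inl m)).partner = none ↔ ∀ f ∈ G.M, f.1 ≠ m := by
      rw [Option.eq_none_iff_forall_ne_some]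
      constructor
      · rintro hp ⟨m', w⟩ hf rfl
        exact hp _ ((h.partnerM m' _).2 ⟨w, hf, rfl⟩)
      · intro hp i hpi
        obtain ⟨w, hw, _⟩ := (h.partnerM m i).1 hpi
        exact hp _ hw rfl
    change i ∈ (if (σ (Sum.inl m)).partner = none then _ else (∅ : Finset ℕ)) ↔ _
    by_cases hp : (σ (Sum.inl m)).partner = none
    · rw [if_pos hp, Finset.mem_filter, h.live]
      constructor
      · rintro ⟨⟨w, hw, rfl⟩, hmin⟩
        refine ⟨w, Core.mem_reset_act.2 ⟨hw, hn.1 hp, ?_⟩, rfl⟩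
        rintro ⟨m', w'⟩ hw' rfl
        have := hmin (ident (Sum.inr w')) ((h.live m' _).2 ⟨w', hw', rfl⟩)
        rwa [quantile_prefs_man hi, quantile_prefs_man hi] at this
      · rintro ⟨w, hw, rfl⟩
        obtain ⟨hw, _, hmin⟩ := Core.mem_reset_act.1 hw
        refine ⟨⟨w, hw, rfl⟩, fun i hi' => ?_⟩
        obtain ⟨w', hw', rfl⟩ := (h.live m i).1 hi'
        rw [quantile_prefs_man hi, quantile_prefs_man hi]
        exact hmin (m, w') hw' rfl
    · rw [if_neg hp]
      simp only [Finset.notMem_empty, false_iff]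
      rintro ⟨w, hw, rfl⟩
      exact hp (hn.2 (Core.mem_reset_act.1 hw).2.1)
  resM := h.resM
  resW := h.resW
  partnerM := h.partnerM
  partnerW := h.partnerW

theorem Rep.offer (h : Rep ident σ G) (hE : ∀ e ∈ G.live, e.2 ∈ P.ofMan e.1) (i : ℕ)
    (r₁ r₂ r₃ : Y ⊕ X → ℕ) :
    Rep ident (gstep k P ident N .hear (gstep k P ident N (.accept i)
      (gstep k P ident N .propose σ r₁) r₂) r₃) (G.offer (quantW k P) i) := by
  set σ₁ := gstep k P ident N .propose σ r₁ with hσ₁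
  set σ₂ := gstep k P ident N (.accept i) σ₁ r₂ with hσ₂
  have h1 : ∀ m, (σ₁ (Sum.inl m)).out = (σ (Sum.inl m)).act ∩ (σ (Sum.inl m)).live :=
    fun m => rfl
  have h2 : ∀ w, (σ₂ (Sum.inr w)).out = (inbox P ident N σ₁ (Sum.inr w)).filter
      fun j => quantile k (localInput P ident N (Sum.inr w)).prefs j = i := fun w => rfl
  have h3 : ∀ w j, j ∈ (σ₂ (Sum.inr w)).out ↔
      ∃ m, (m, w) ∈ (G.offer (quantW k P) i).res ∧ ident (Sum.inl m) = j := by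
    intro w j
    rw [h2, Finset.mem_filter, mem_inbox_woman hi]
    simp only [h1, Finset.mem_inter, h.act, h.live, exists_woman_iff hi, Core.mem_offer_res]
    constructor
    · rintro ⟨⟨m, ⟨_, hm⟩, rfl⟩, hq⟩
      rw [quantile_prefs_woman hi] at hq
      exact ⟨m, ⟨hm, hq⟩, rfl⟩
    · rintro ⟨m, ⟨hm, hq⟩, rfl⟩
      refine ⟨⟨m, ⟨hE _ hm.2, hm⟩, rfl⟩, ?_⟩
      rwa [quantile_prefs_woman hi]
  refine ⟨h.live, h.act, fun m j => ?_, h3, h.partnerM, h.partnerW⟩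
  change j ∈ inbox P ident N σ₂ (Sum.inl m) ↔ _
  rw [mem_inbox_man hi]
  simp only [h3, exists_man_iff hi]
  constructor
  · rintro ⟨w, ⟨_, hw⟩, rfl⟩
    exact ⟨w, hw, rfl⟩
  · rintro ⟨w, hw, rfl⟩
    exact ⟨w, ⟨hE _ (Core.mem_offer_res.1 hw).1.2, hw⟩, rfl⟩

theorem Rep.clean {qm qw : Y × X → ℕ} (h : Rep ident σ G) (hG : G.Inv qm qw E)
    (hE : ∀ e ∈ E, e.2 ∈ P.ofMan e.1) (r₁ r₂ : Y ⊕ X → ℕ) :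
    Rep ident (gstep k P ident N .heed (gstep k P ident N .clean σ r₁) r₂) G.clean := by
  set σ₁ := gstep k P ident N .clean σ r₁ with hσ₁
  have h1 : ∀ w, (σ₁ (Sum.inr w)).out = (σ (Sum.inr w)).resid := fun w => rfl
  have h2 : ∀ m i, i ∈ inbox P ident N σ₁ (Sum.inl m) ↔
      ∃ w, (m, w) ∈ G.res ∧ ident (Sum.inr w) = i := by
    intro m i
    rw [mem_inbox_man hi]
    simp only [h1, h.resW, exists_man_iff hi]
    constructor
    · rintro ⟨w, ⟨_, hw⟩, rfl⟩
      exact ⟨w, hw, rfl⟩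
    · rintro ⟨w, hw, rfl⟩
      exact ⟨w, ⟨hE _ (hG.live_sub (Finset.mem_inter.1 (hG.res_sub hw)).2), hw⟩, rfl⟩
  refine ⟨fun m i => ?_, h.act, fun m i => ?_, fun w i => ?_, fun m i => ?_, h.partnerW⟩
  · change i ∈ (σ (Sum.inl m)).live \ inbox P ident N σ₁ (Sum.inl m) ↔ _
    rw [Finset.mem_sdiff, h.live, h2]
    constructor
    · rintro ⟨⟨w, hw, rfl⟩, hn⟩
      exact ⟨w, Finset.mem_sdiff.2 ⟨hw, fun hr => hn ⟨w, hr, rfl⟩⟩, rfl⟩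
    · rintro ⟨w, hw, rfl⟩
      have hw' := Finset.mem_sdiff.1 hw
      simp only [exists_woman_iff hi]
      exact hw'
  · change i ∈ (∅ : Finset ℕ) \ _ ↔ ∃ w, (m, w) ∈ (∅ : Finset (Y × X)) ∧ _
    simp
  · change i ∈ (∅ : Finset ℕ) \ _ ↔ ∃ m, (m, w) ∈ (∅ : Finset (Y × X)) ∧ _
    simp
  · change (σ (Sum.inl m)).partner.filter (fun p => p ∉ inbox P ident N σ₁ (Sum.inl m)) = some i ↔ _
    rw [Option.filter_eq_some_iff, h.partnerM]
    simp only [decide_eq_true_eq, h2]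
    -- The filter discards no partner: by `act_free`, a matched man has no residual edge.
    refine ⟨fun hp => hp.1, fun hp => ⟨hp, ?_⟩⟩
    obtain ⟨w, hw, rfl⟩ := hp
    rw [exists_woman_iff hi]
    intro hr
    exact hG.act_free _ (Finset.mem_inter.1 (hG.res_sub hr)).1 _ hw rfl

end Ident

/-! #### An iteration of the maximal matching procedure -/

/-- The neighbour picked in the residual graph with the random number `r`. -/
def pickOf (s : Loc) (r : ℕ) : Option ℕ := (s.resid.sort (· ≤ ·))[r % (2 * s.resid.card)]?

theorem mem_of_pickOf {s : Loc} {r i : ℕ} (h : pickOf s r = some i) : i ∈ s.resid := by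
  have := List.mem_of_getElem? h
  simpa using this

/-- The processor `v` is not itself a proposer, and some processor has picked `v`. -/
def Hit (ident : Y ⊕ X → ℕ) (σ : Y ⊕ X → Loc) (r : Y ⊕ X → ℕ) (v : Y ⊕ X) : Prop :=
  pickOf (σ v) (r v) = none ∧ ∃ u, pickOf (σ u) (r u) = some (ident v)

/-- The states after an iteration of the maximal matching procedure. -/
def iterStep (k : ℕ) (P : Preferences X Y) (ident : Y ⊕ X → ℕ) (N : ℕ) (σ : Y ⊕ X → Loc)
    (r : Y ⊕ X → ℕ) : Y ⊕ X → Loc :=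
  gstep k P ident N .heed (gstep k P ident N .confirm (gstep k P ident N .reply
    (gstep k P ident N .draw σ r) fun _ => 0) fun _ => 0) fun _ => 0

/-- `v` replies to `i`. -/
def Replies (k : ℕ) (P : Preferences X Y) (ident : Y ⊕ X → ℕ) (N : ℕ) (σ : Y ⊕ X → Loc)
    (r : Y ⊕ X → ℕ) (v : Y ⊕ X) (i : ℕ) : Prop :=
  pickOf (σ v) (r v) = none ∧
    ∃ h : (inbox P ident N (gstep k P ident N .draw σ r) v).Nonempty,
      (inbox P ident N (gstep k P ident N .draw σ r) v).min' h = i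

/-- `v` is matched with `i` in this iteration. -/
def Matched (k : ℕ) (P : Preferences X Y) (ident : Y ⊕ X → ℕ) (N : ℕ) (σ : Y ⊕ X → Loc)
    (r : Y ⊕ X → ℕ) (v : Y ⊕ X) (i : ℕ) : Prop :=
  Replies k P ident N σ r v i ∨
    pickOf (σ v) (r v) = some i ∧ ∃ u, ident u = i ∧ Replies k P ident N σ r u (ident v)

theorem Replies.unique {r : Y ⊕ X → ℕ} {v : Y ⊕ X} {i j : ℕ}
    (h : Replies k P ident N σ r v i) (h' : Replies k P ident N σ r v j) : i = j := by
  obtain ⟨_, _, rfl⟩ := h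
  obtain ⟨_, _, rfl⟩ := h'
  rfl

/-- Replying requires having picked nobody, so the two ways of being matched exclude each other, and
each of them determines the partner. -/
theorem Matched.unique {r : Y ⊕ X → ℕ} {v : Y ⊕ X} {i j : ℕ}
    (h : Matched k P ident N σ r v i) (h' : Matched k P ident N σ r v j) : i = j := by
  rcases h with h | ⟨h, _⟩ <;> rcases h' with h' | ⟨h', _⟩
  · exact h.unique h'
  · rw [h.1] at h'; cases h'
  · rw [h'.1] at h; cases h
  · exact Option.some_injective _ (h.symm.trans h')

section Ident

variable (hi : Function.Injective ident)

include hi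

theorem mem_inbox_draw {r : Y ⊕ X → ℕ} {v : Y ⊕ X} {i : ℕ} :
    i ∈ inbox P ident N (gstep k P ident N .draw σ r) v ↔
      ∃ u ∈ P.neighbors v, ident u = i ∧ pickOf (σ u) (r u) = some (ident v) := by
  have h : ∀ u, (gstep k P ident N .draw σ r u).out = (pickOf (σ u) (r u)).toFinset :=
    fun u => rfl
  simp [mem_inbox hi, h]

theorem Replies.pickOf {r : Y ⊕ X → ℕ} {v u : Y ⊕ X}
    (h : Replies k P ident N σ r v (ident u)) : pickOf (σ u) (r u) = some (ident v) := by
  obtain ⟨_, hn, he⟩ := h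
  have := Finset.min'_mem _ hn
  rw [he] at this
  obtain ⟨u', _, hu', hp⟩ := (mem_inbox_draw hi).1 this
  rwa [← hi hu']

theorem Replies.exists {r : Y ⊕ X → ℕ} {v : Y ⊕ X} {i : ℕ}
    (h : Replies k P ident N σ r v i) : ∃ u ∈ P.neighbors v, ident u = i := by
  obtain ⟨_, hn, rfl⟩ := h
  obtain ⟨u, hu, hu', _⟩ := (mem_inbox_draw hi).1 (Finset.min'_mem _ hn)
  exact ⟨u, hu, hu'⟩

/-- The state of a processor after the third round of an iteration. -/
theorem confirm_of_matched {r : Y ⊕ X → ℕ} (v : Y ⊕ X)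
    (hres : ∀ i ∈ (σ v).resid, ∃ u ∈ P.neighbors v, ident u = i) (τ : Y ⊕ X → Loc)
    (hτ : τ = gstep k P ident N .confirm (gstep k P ident N .reply
      (gstep k P ident N .draw σ r) fun _ => 0) fun _ => 0) :
    (τ v).live = (σ v).live ∧
    (∀ i, Matched k P ident N σ r v i →
      (τ v).partner = some i ∧ (τ v).act = ∅ ∧ (τ v).resid = ∅) ∧
    ((∀ i, ¬ Matched k P ident N σ r v i) →
      (τ v).partner = (σ v).partner ∧ (τ v).act = (σ v).act ∧ (τ v).resid = (σ v).resid) ∧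
    (τ v).out = refused k (localInput P ident N v) (τ v).partner := by
  set σ₁ := gstep k P ident N .draw σ r with hσ₁
  set σ₂ := gstep k P ident N .reply σ₁ (fun _ => 0) with hσ₂
  have hp₁ : ∀ u, (σ₁ u).pick = pickOf (σ u) (r u) := fun u => rfl
  have hout : ∀ u i, i ∈ (σ₂ u).out ↔ Replies k P ident N σ r u i := by
    intro u i
    by_cases h : (σ₁ u).pick = none ∧ (inbox P ident N σ₁ u).Nonempty
    · have h2 : σ₂ u = { σ₁ u with
          partner := some ((inbox P ident N σ₁ u).min' h.2)
          act := ∅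
          resid := ∅
          out := {(inbox P ident N σ₁ u).min' h.2} } := dif_pos h
      rw [h2]
      simp only [Finset.mem_singleton]
      exact ⟨fun he => ⟨h.1, h.2, he.symm⟩, fun he => he.2.2.symm⟩
    · have h2 : σ₂ u = { σ₁ u with out := ∅ } := dif_neg h
      rw [h2]
      simp only [Finset.notMem_empty, false_iff]
      exact fun he => h ⟨he.1, he.2.1⟩
  have hpick : (σ₂ v).pick = pickOf (σ v) (r v) := by
    by_cases h : (σ₁ v).pick = none ∧ (inbox P ident N σ₁ v).Nonempty
    · have h2 : σ₂ v = { σ₁ v with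
          partner := some ((inbox P ident N σ₁ v).min' h.2)
          act := ∅
          resid := ∅
          out := {(inbox P ident N σ₁ v).min' h.2} } := dif_pos h
      rw [h2]; exact hp₁ v
    · have h2 : σ₂ v = { σ₁ v with out := ∅ } := dif_neg h
      rw [h2]; exact hp₁ v
  -- Replies travel only along edges; `hres` ensures that the picked identifier is that of a
  -- neighbour, so its reply arrives.
  have hcond : (∃ u ∈ (σ₂ v).pick, u ∈ inbox P ident N σ₂ v) ↔
      ∃ i, pickOf (σ v) (r v) = some i ∧ ∃ u, ident u = i ∧ Replies k P ident N σ r u (ident v) := by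
    rw [hpick]
    refine exists_congr fun i => and_congr_right fun hpi => ?_
    rw [mem_inbox hi]
    constructor
    · rintro ⟨u, _, hu, hu'⟩
      exact ⟨u, hu, (hout _ _).1 hu'⟩
    · rintro ⟨u, hu, hu'⟩
      obtain ⟨u', hu1, hu2⟩ := hres i (mem_of_pickOf hpi)
      obtain rfl := hi (hu.trans hu2.symm)
      exact ⟨u, hu1, hu, (hout _ _).2 hu'⟩
  have hτv : τ v = (gstep k P ident N .confirm σ₂ fun _ => 0) v := by rw [hτ]
  by_cases hc : ∃ u ∈ (σ₂ v).pick, u ∈ inbox P ident N σ₂ v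
  · have h3 : (if ∃ u ∈ (σ₂ v).pick, u ∈ inbox P ident N σ₂ v then
        { σ₂ v with partner := (σ₂ v).pick, act := ∅, resid := ∅ } else σ₂ v) =
        { σ₂ v with partner := (σ₂ v).pick, act := ∅, resid := ∅ } := if_pos hc
    obtain ⟨i, hpi, hu⟩ := hcond.1 hc
    have hm : Matched k P ident N σ r v i := Or.inr ⟨hpi, hu⟩
    have hne : ¬ ((σ₁ v).pick = none ∧ (inbox P ident N σ₁ v).Nonempty) := by
      rintro ⟨h, _⟩
      rw [hp₁, hpi] at h
      cases h
    have h2 : σ₂ v = { σ₁ v with out := ∅ } := dif_neg hne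
    have hl : (τ v).live = (σ v).live := by
      rw [hτv]
      simp only [gstep, Instr.exec, h3]
      rw [h2]; rfl
    have hp : (τ v).partner = some i := by
      rw [hτv]
      simp only [gstep, Instr.exec, h3]
      rw [hpick, hpi]
    refine ⟨hl, fun j hj => ⟨?_, ?_, ?_⟩, fun hn => absurd hm (hn i), ?_⟩
    · rw [hp, hm.unique hj]
    · rw [hτv]; simp only [gstep, Instr.exec, h3]
    · rw [hτv]; simp only [gstep, Instr.exec, h3]
    · rw [hτv]; simp only [gstep, Instr.exec, h3]
  · have h3 : (if ∃ u ∈ (σ₂ v).pick, u ∈ inbox P ident N σ₂ v then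
        { σ₂ v with partner := (σ₂ v).pick, act := ∅, resid := ∅ } else σ₂ v) =
        σ₂ v := if_neg hc
    have h4 : (τ v).live = (σ₂ v).live ∧ (τ v).partner = (σ₂ v).partner ∧
        (τ v).act = (σ₂ v).act ∧ (τ v).resid = (σ₂ v).resid := by
      rw [hτv]; simp only [gstep, Instr.exec, h3]; simp
    have h5 : (τ v).out = refused k (localInput P ident N v) (τ v).partner := by
      rw [hτv]; simp only [gstep, Instr.exec, h3]
    have hnQ := fun h => hc (hcond.2 h)
    by_cases h : (σ₁ v).pick = none ∧ (inbox P ident N σ₁ v).Nonempty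
    · have h2 : σ₂ v = { σ₁ v with
          partner := some ((inbox P ident N σ₁ v).min' h.2)
          act := ∅
          resid := ∅
          out := {(inbox P ident N σ₁ v).min' h.2} } := dif_pos h
      have hR : Replies k P ident N σ r v ((inbox P ident N σ₁ v).min' h.2) := ⟨h.1, h.2, rfl⟩
      refine ⟨?_, fun j hj => ⟨?_, ?_, ?_⟩, fun hn => absurd (Or.inl hR) (hn _), h5⟩
      · rw [h4.1, h2]; rfl
      · rw [h4.2.1, h2, ← Matched.unique (Or.inl hR) hj]
      · rw [h4.2.2.1, h2]
      · rw [h4.2.2.2, h2]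
    · have h2 : σ₂ v = { σ₁ v with out := ∅ } := dif_neg h
      refine ⟨?_, fun j hj => ?_, fun _ => ⟨?_, ?_, ?_⟩, h5⟩
      · rw [h4.1, h2]; rfl
      · rcases hj with hj | hj
        · exact absurd ⟨hj.1, hj.2.1⟩ h
        · exact absurd ⟨j, hj⟩ hnQ
      · rw [h4.2.1, h2]; rfl
      · rw [h4.2.2.1, h2]; rfl
      · rw [h4.2.2.2, h2]; rfl

theorem mem_refused_man {m : Y} {w : X} {o : Option ℕ} :
    ident (Sum.inr w) ∈ refused k (localInput P ident N (Sum.inl m)) o ↔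
      w ∈ P.ofMan m ∧ ∃ p, o = some p ∧ ident (Sum.inr w) ≠ p := by
  cases o with
  | none => simp [refused]
  | some p =>
    change _ ∈ Finset.filter _ _ ↔ _
    rw [Finset.mem_filter, ident_mem_prefs_man hi]
    simp

theorem mem_refused_woman {m : Y} {w : X} {o : Option ℕ} :
    ident (Sum.inl m) ∈ refused k (localInput P ident N (Sum.inr w)) o ↔
      w ∈ P.ofMan m ∧ ∃ p, o = some p ∧ ident (Sum.inl m) ≠ p ∧
        quantile k (localInput P ident N (Sum.inr w)).prefs p ≤ quantW k P (m, w) := by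
  cases o with
  | none => simp [refused]
  | some p =>
    change _ ∈ Finset.filter _ _ ↔ _
    rw [Finset.mem_filter, ident_mem_prefs_woman hi, quantile_prefs_woman hi]
    simp

/-- An iteration of the maximal matching procedure adds a matching `μ` in the residual graph, which
covers every processor that is hit. -/
theorem Rep.iter {qm : Y × X → ℕ} (h : Rep ident σ G) (hG : G.Inv qm (quantW k P) E)
    (hE : ∀ e ∈ E, e.2 ∈ P.ofMan e.1) (r : Y ⊕ X → ℕ) :
    ∃ μ ⊆ G.res, Disj μ ∧
      Rep ident (iterStep k P ident N σ r) (G.iter (quantW k P) μ) ∧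
      (∀ m, Hit ident σ r (Sum.inl m) → ∃ f ∈ μ, f.1 = m) ∧
      (∀ w, Hit ident σ r (Sum.inr w) → ∃ f ∈ μ, f.2 = w) := by
  classical
  have hresE : ∀ e ∈ G.res, e.2 ∈ P.ofMan e.1 := fun e he =>
    hE e (hG.live_sub (Finset.mem_inter.1 (hG.res_sub he)).2)
  -- typing of the residual graph
  have hM : ∀ m, ∀ i ∈ (σ (Sum.inl m)).resid, ∃ u ∈ P.neighbors (Sum.inl m), ident u = i := by
    intro m i hmi
    obtain ⟨w, hw, rfl⟩ := (h.resM m i).1 hmi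
    exact ⟨Sum.inr w, List.mem_map_of_mem (hresE _ hw), rfl⟩
  have hW : ∀ w, ∀ i ∈ (σ (Sum.inr w)).resid, ∃ u ∈ P.neighbors (Sum.inr w), ident u = i := by
    intro w i hwi
    obtain ⟨m, hm, rfl⟩ := (h.resW w i).1 hwi
    exact ⟨Sum.inl m, List.mem_map_of_mem ((P.symmetric m w).2 (hresE _ hm)), rfl⟩
  have hpickM : ∀ m i, pickOf (σ (Sum.inl m)) (r (Sum.inl m)) = some i →
      ∃ w, (m, w) ∈ G.res ∧ ident (Sum.inr w) = i :=
    fun m i hp => (h.resM m i).1 (mem_of_pickOf hp)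
  have hpickW : ∀ w i, pickOf (σ (Sum.inr w)) (r (Sum.inr w)) = some i →
      ∃ m, (m, w) ∈ G.res ∧ ident (Sum.inl m) = i :=
    fun w i hp => (h.resW w i).1 (mem_of_pickOf hp)
  have hRM : ∀ m i, Replies k P ident N σ r (Sum.inl m) i →
      ∃ w, (m, w) ∈ G.res ∧ ident (Sum.inr w) = i := by
    intro m i hr
    obtain ⟨u, hu, rfl⟩ := hr.exists hi
    obtain ⟨w, _, rfl⟩ := List.mem_map.1 hu
    obtain ⟨m', hm', he⟩ := hpickW w _ (hr.pickOf hi)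
    rw [Sum.inl_injective (hi he)] at hm'
    exact ⟨w, hm', rfl⟩
  have hRW : ∀ w i, Replies k P ident N σ r (Sum.inr w) i →
      ∃ m, (m, w) ∈ G.res ∧ ident (Sum.inl m) = i := by
    intro w i hr
    obtain ⟨u, hu, rfl⟩ := hr.exists hi
    obtain ⟨m, _, rfl⟩ := List.mem_map.1 hu
    obtain ⟨w', hw', he⟩ := hpickM m _ (hr.pickOf hi)
    rw [Sum.inr_injective (hi he)] at hw'
    exact ⟨m, hw', rfl⟩
  -- Both sexes pick and reply, so either endpoint may be the one that replies.
  set μ : Finset (Y × X) := G.res.filter fun e =>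
    Replies k P ident N σ r (Sum.inl e.1) (ident (Sum.inr e.2)) ∨
    Replies k P ident N σ r (Sum.inr e.2) (ident (Sum.inl e.1)) with hμdef
  have hμ : μ ⊆ G.res := Finset.filter_subset _ _
  have hmatM : ∀ m i, Matched k P ident N σ r (Sum.inl m) i ↔
      ∃ w, (m, w) ∈ μ ∧ ident (Sum.inr w) = i := by
    intro m i
    constructor
    · rintro (hr | ⟨hp, u, rfl, hr⟩)
      · obtain ⟨w, hw, rfl⟩ := hRM m i hr
        exact ⟨w, Finset.mem_filter.2 ⟨hw, Or.inl hr⟩, rfl⟩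
      · obtain ⟨w, hw, he⟩ := hpickM m _ hp
        obtain rfl := hi he
        exact ⟨w, Finset.mem_filter.2 ⟨hw, Or.inr hr⟩, rfl⟩
    · rintro ⟨w, hw, rfl⟩
      rcases (Finset.mem_filter.1 hw).2 with hr | hr
      · exact Or.inl hr
      · exact Or.inr ⟨hr.pickOf hi, _, rfl, hr⟩
  have hmatW : ∀ w i, Matched k P ident N σ r (Sum.inr w) i ↔
      ∃ m, (m, w) ∈ μ ∧ ident (Sum.inl m) = i := by
    intro w i
    constructor
    · rintro (hr | ⟨hp, u, rfl, hr⟩)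
      · obtain ⟨m, hm, rfl⟩ := hRW w i hr
        exact ⟨m, Finset.mem_filter.2 ⟨hm, Or.inr hr⟩, rfl⟩
      · obtain ⟨m, hm, he⟩ := hpickW w _ hp
        obtain rfl := hi he
        exact ⟨m, Finset.mem_filter.2 ⟨hm, Or.inl hr⟩, rfl⟩
    · rintro ⟨m, hm, rfl⟩
      rcases (Finset.mem_filter.1 hm).2 with hr | hr
      · exact Or.inr ⟨hr.pickOf hi, _, rfl, hr⟩
      · exact Or.inl hr
  have hd : Disj μ := by
    rintro ⟨m, w⟩ he ⟨m', w'⟩ hf hef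
    rcases hef with rfl | rfl
    · have := Matched.unique ((hmatM m _).2 ⟨w, he, rfl⟩) ((hmatM m _).2 ⟨w', hf, rfl⟩)
      rw [Sum.inr_injective (hi this)]
    · have := Matched.unique ((hmatW w _).2 ⟨m, he, rfl⟩) ((hmatW w _).2 ⟨m', hf, rfl⟩)
      rw [Sum.inl_injective (hi this)]
  have hG' := hG.iter hμ hd
  -- the states before the last round
  set τ := gstep k P ident N .confirm (gstep k P ident N .reply
      (gstep k P ident N .draw σ r) fun _ => 0) (fun _ => 0) with hτ
  have hcM := fun m => confirm_of_matched hi (k := k) (N := N) (r := r) (Sum.inl m) (hM m) τ hτ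
  have hcW := fun w => confirm_of_matched hi (k := k) (N := N) (r := r) (Sum.inr w) (hW w) τ hτ
  have hnewM : ∀ m, (∃ f ∈ μ, f.1 = m) → ∃ w, (m, w) ∈ μ ∧
      (τ (Sum.inl m)).partner = some (ident (Sum.inr w)) ∧ (τ (Sum.inl m)).act = ∅ ∧
      (τ (Sum.inl m)).resid = ∅ := by
    rintro m ⟨⟨m, w⟩, hf, rfl⟩
    exact ⟨w, hf, (hcM m).2.1 _ ((hmatM m _).2 ⟨w, hf, rfl⟩)⟩
  have hnewW : ∀ w, (∃ f ∈ μ, f.2 = w) → ∃ m, (m, w) ∈ μ ∧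
      (τ (Sum.inr w)).partner = some (ident (Sum.inl m)) ∧ (τ (Sum.inr w)).resid = ∅ := by
    rintro w ⟨⟨m, w⟩, hf, rfl⟩
    have := (hcW w).2.1 _ ((hmatW w _).2 ⟨m, hf, rfl⟩)
    exact ⟨m, hf, this.1, this.2.2⟩
  have holdM : ∀ m, (∀ f ∈ μ, f.1 ≠ m) →
      (τ (Sum.inl m)).partner = (σ (Sum.inl m)).partner ∧
      (τ (Sum.inl m)).act = (σ (Sum.inl m)).act ∧
      (τ (Sum.inl m)).resid = (σ (Sum.inl m)).resid := by
    intro m hm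
    refine (hcM m).2.2.1 fun i hmi => ?_
    obtain ⟨w, hw, _⟩ := (hmatM m i).1 hmi
    exact hm _ hw rfl
  have holdW : ∀ w, (∀ f ∈ μ, f.2 ≠ w) →
      (τ (Sum.inr w)).partner = (σ (Sum.inr w)).partner ∧
      (τ (Sum.inr w)).resid = (σ (Sum.inr w)).resid := by
    intro w hw
    have := (hcW w).2.2.1 fun i hwi => by
      obtain ⟨m, hm, _⟩ := (hmatW w i).1 hwi
      exact hw _ hm rfl
    exact ⟨this.1, this.2.2⟩
  have hpartW : ∀ w i, (τ (Sum.inr w)).partner = some i ↔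
      ∃ m, (m, w) ∈ G.newM μ ∧ ident (Sum.inl m) = i := by
    intro w i
    by_cases hw : ∃ f ∈ μ, f.2 = w
    · obtain ⟨m, hm, hp, _⟩ := hnewW w hw
      rw [hp]
      constructor
      · rintro hmi
        exact ⟨m, Core.mem_newM.2 (Or.inr hm), Option.some_injective _ hmi⟩
      · rintro ⟨m', hm', rfl⟩
        have := hG'.disj _ hm' _ (Core.mem_newM.2 (Or.inr hm)) (Or.inr rfl)
        rw [show m' = m from (Prod.ext_iff.1 this).1]
    · push Not at hw
      rw [(holdW w hw).1, h.partnerW]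
      refine exists_congr fun m => and_congr_left fun _ => ?_
      rw [Core.mem_newM]
      exact ⟨fun hm => Or.inl ⟨hm, hw⟩, fun hm => hm.elim And.left
        fun hm => absurd rfl (hw _ hm)⟩
  have houtW : ∀ m w, w ∈ P.ofMan m → (ident (Sum.inl m) ∈ (τ (Sum.inr w)).out ↔
      ∃ f ∈ G.newM μ, f.2 = w ∧ f.1 ≠ m ∧ quantW k P f ≤ quantW k P (m, w)) := by
    intro m w hmw
    rw [(hcW w).2.2.2, mem_refused_woman hi]
    constructor
    · rintro ⟨_, p, hp, hne, hq⟩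
      obtain ⟨m', hm', rfl⟩ := (hpartW w p).1 hp
      rw [quantile_prefs_woman hi] at hq
      exact ⟨(m', w), hm', rfl, fun hmm : m' = m => hne (by rw [hmm]), hq⟩
    · rintro ⟨⟨m', w⟩, hf, rfl, hne, hq⟩
      refine ⟨hmw, _, (hpartW w _).2 ⟨m', hf, rfl⟩, fun he => ?_, ?_⟩
      · exact hne (Sum.inl_injective (hi he)).symm
      · rwa [quantile_prefs_woman hi]
  have hinM : ∀ m w, (m, w) ∈ G.live → (ident (Sum.inr w) ∈ inbox P ident N τ (Sum.inl m) ↔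
      ∃ f ∈ G.newM μ, f.2 = w ∧ f.1 ≠ m ∧ quantW k P f ≤ quantW k P (m, w)) := by
    intro m w hl
    have hmw := hE _ (hG.live_sub hl)
    rw [mem_inbox_man hi, exists_woman_iff hi (p := fun w' => w' ∈ P.ofMan m ∧ _), houtW m w hmw]
    exact and_iff_right hmw
  have hinW : ∀ m w, (m, w) ∈ G.res → (ident (Sum.inl m) ∈ inbox P ident N τ (Sum.inr w) ↔
      ∃ p, (τ (Sum.inl m)).partner = some p ∧ ident (Sum.inr w) ≠ p) := by
    intro m w hr
    have hmw := hresE _ hr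
    rw [mem_inbox_woman hi, exists_man_iff hi (p := fun m' => w ∈ P.ofMan m' ∧ _),
      (hcM m).2.2.2, mem_refused_man hi]
    exact ⟨fun h => h.2.2, fun h => ⟨hmw, hmw, h⟩⟩
  refine ⟨μ, hμ, hd, ⟨fun m i => ?_, fun m i => ?_, fun m i => ?_, fun w i => ?_,
    fun m i => ?_, hpartW⟩, fun m hm => ?_, fun w hw => ?_⟩
  · change i ∈ (τ (Sum.inl m)).live \ inbox P ident N τ (Sum.inl m) ↔ _
    rw [Finset.mem_sdiff, (hcM m).1, h.live]
    constructor
    · rintro ⟨⟨w, hw, rfl⟩, hn⟩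
      rw [hinM m w hw] at hn
      refine ⟨w, Core.mem_iter_live.2 ⟨hw, fun f hf hfw hfe => ?_⟩, rfl⟩
      by_contra hq
      exact hn ⟨f, hf, hfw, fun hfm => hfe (Prod.ext hfm hfw), not_lt.1 hq⟩
    · rintro ⟨w, hw, rfl⟩
      obtain ⟨hw, hw'⟩ := Core.mem_iter_live.1 hw
      refine ⟨⟨w, hw, rfl⟩, ?_⟩
      rw [hinM m w hw]
      rintro ⟨f, hf, hfw, hfm, hq⟩
      exact absurd (hw' f hf hfw fun hfe => hfm (by rw [hfe])) (not_lt.2 hq)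
  · change i ∈ (τ (Sum.inl m)).act ↔ _
    by_cases hm : ∃ f ∈ μ, f.1 = m
    · obtain ⟨w, hw, _, ha, _⟩ := hnewM m hm
      rw [ha]
      simp only [Finset.notMem_empty, false_iff]
      rintro ⟨w', hw', _⟩
      exact (Core.mem_iter_act.1 hw').2 _ hw rfl
    · push Not at hm
      rw [(holdM m hm).2.1, h.act]
      refine exists_congr fun w => and_congr_left fun _ => ?_
      rw [Core.mem_iter_act]
      exact ⟨fun hw => ⟨hw, hm⟩, And.left⟩
  · change i ∈ (τ (Sum.inl m)).resid \ inbox P ident N τ (Sum.inl m) ↔ _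
    rw [Finset.mem_sdiff]
    by_cases hm : ∃ f ∈ μ, f.1 = m
    · obtain ⟨w, hw, _, _, ha⟩ := hnewM m hm
      rw [ha]
      simp only [Finset.notMem_empty, false_and, false_iff]
      rintro ⟨w', hw', _⟩
      exact ((Core.mem_iter_res.1 hw').2 _ hw).1 rfl
    · push Not at hm
      rw [(holdM m hm).2.2, h.resM]
      constructor
      · rintro ⟨⟨w, hw, rfl⟩, hn⟩
        rw [hinM m w (Finset.mem_inter.1 (hG.res_sub hw)).2] at hn
        refine ⟨w, Core.mem_iter_res.2 ⟨hw, fun f hf => ⟨hm f hf, fun hfw => hn ?_⟩⟩, rfl⟩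
        -- Equality of quantiles is enough here: the woman also refuses men in the quantile of her
        -- new partner.
        exact ⟨f, Core.mem_newM.2 (Or.inr hf), hfw, hm f hf,
          (hG.res_level f (hμ hf) _ hw hfw).le⟩
      · rintro ⟨w, hw, rfl⟩
        obtain ⟨hw, hw'⟩ := Core.mem_iter_res.1 hw
        have hl := (Finset.mem_inter.1 (hG.res_sub hw)).2
        refine ⟨⟨w, hw, rfl⟩, ?_⟩
        rw [hinM m w hl]
        rintro ⟨f, hf, hfw, hfm, hq⟩
        rcases Core.mem_newM.1 hf with ⟨hf, _⟩ | hf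
        · exact absurd (hG.better _ hl f hf hfw fun hfe => hfm (by rw [hfe])) (not_lt.2 hq)
        · exact (hw' f hf).2 hfw
  · change i ∈ (τ (Sum.inr w)).resid \ inbox P ident N τ (Sum.inr w) ↔ _
    rw [Finset.mem_sdiff]
    by_cases hw : ∃ f ∈ μ, f.2 = w
    · obtain ⟨m, hm, _, ha⟩ := hnewW w hw
      rw [ha]
      simp only [Finset.notMem_empty, false_and, false_iff]
      rintro ⟨m', hm', _⟩
      exact ((Core.mem_iter_res.1 hm').2 _ hm).2 rfl
    · push Not at hw
      rw [(holdW w hw).2, h.resW]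
      constructor
      · rintro ⟨⟨m, hm, rfl⟩, hn⟩
        rw [hinW m w hm] at hn
        refine ⟨m, Core.mem_iter_res.2 ⟨hm, fun f hf => ⟨fun hfm => ?_, hw f hf⟩⟩, rfl⟩
        obtain ⟨w', hw', hp, _⟩ := hnewM m ⟨f, hf, hfm⟩
        exact hn ⟨_, hp, fun he => hw _ hw' (Sum.inr_injective (hi he)).symm⟩
      · rintro ⟨m, hm, rfl⟩
        obtain ⟨hm, hm'⟩ := Core.mem_iter_res.1 hm
        refine ⟨⟨m, hm, rfl⟩, ?_⟩
        rw [hinW m w hm]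
        rintro ⟨p, hp, _⟩
        -- The man of a residual edge has no earlier partner, so he sends refusals only if he is
        -- matched in this iteration.
        rw [(holdM m fun f hf => (hm' f hf).1).1] at hp
        obtain ⟨w', hw', _⟩ := (h.partnerM m p).1 hp
        exact hG.act_free _ (Finset.mem_inter.1 (hG.res_sub hm)).1 _ hw' rfl
  · change (τ (Sum.inl m)).partner.filter (fun p => p ∉ inbox P ident N τ (Sum.inl m)) = some i ↔ _
    rw [Option.filter_eq_some_iff, decide_eq_true_eq]
    have hnot : ∀ w, (m, w) ∈ G.newM μ →
        ident (Sum.inr w) ∉ inbox P ident N τ (Sum.inl m) := by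
      intro w hw
      rw [hinM m w (Core.mem_iter_live.1 (hG'.sub_live hw)).1]
      rintro ⟨f, hf, hfw, hfm, _⟩
      exact hfm (Prod.ext_iff.1 (hG'.disj f hf _ hw (Or.inr hfw))).1
    by_cases hm : ∃ f ∈ μ, f.1 = m
    · obtain ⟨w, hw, hp, _, _⟩ := hnewM m hm
      have hw2 := Core.mem_newM (G := G).2 (Or.inr hw)
      rw [hp]
      constructor
      · rintro ⟨he, _⟩
        exact ⟨w, hw2, Option.some_injective _ he⟩
      · rintro ⟨w', hw', rfl⟩
        have : w' = w := (Prod.ext_iff.1 (hG'.disj _ hw' _ hw2 (Or.inl rfl))).2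
        refine ⟨by rw [this], hnot w' hw'⟩
    · push Not at hm
      rw [(holdM m hm).1, h.partnerM]
      constructor
      · rintro ⟨⟨w, hw, rfl⟩, hn⟩
        rw [hinM m w (hG.sub_live hw)] at hn
        refine ⟨w, Core.mem_newM.2 (Or.inl ⟨hw, fun f hf hfw => hn ?_⟩), rfl⟩
        -- The displaced partner learns of it through a refusal, since the new partner lies in a
        -- strictly better quantile.
        exact ⟨f, Core.mem_newM.2 (Or.inr hf), hfw, hm f hf,
          (hG.lt_of_mem hμ hf hw hfw.symm).le⟩
      · rintro ⟨w, hw, rfl⟩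
        refine ⟨⟨w, ?_, rfl⟩, hnot w hw⟩
        rcases Core.mem_newM.1 hw with hw | hw
        · exact hw.1
        · exact absurd rfl (hm _ hw)
  · obtain ⟨hp, u, hu⟩ := hm
    have hn : (inbox P ident N (gstep k P ident N .draw σ r) (Sum.inl m)).Nonempty := by
      refine ⟨ident u, (mem_inbox_draw hi).2 ⟨u, ?_, rfl, hu⟩⟩
      cases u with
      | inl m' =>
        obtain ⟨w, _, hw⟩ := hpickM m' _ hu
        exact absurd (hi hw) (by simp)
      | inr w =>
        obtain ⟨m', hm', he⟩ := hpickW w _ hu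
        rw [Sum.inl_injective (hi he)] at hm'
        exact List.mem_map_of_mem (hresE _ hm')
    obtain ⟨w, hw, _⟩ := (hmatM m _).1 (Or.inl ⟨hp, hn, rfl⟩)
    exact ⟨_, hw, rfl⟩
  · obtain ⟨hp, u, hu⟩ := hw
    have hn : (inbox P ident N (gstep k P ident N .draw σ r) (Sum.inr w)).Nonempty := by
      refine ⟨ident u, (mem_inbox_draw hi).2 ⟨u, ?_, rfl, hu⟩⟩
      cases u with
      | inl m =>
        obtain ⟨w', hw', he⟩ := hpickM m _ hu
        rw [Sum.inr_injective (hi he)] at hw'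
        exact List.mem_map_of_mem ((P.symmetric _ _).2 (hresE _ hw'))
      | inr w' =>
        obtain ⟨m, _, hm⟩ := hpickW w' _ hu
        exact absurd (hi hm) (by simp)
    obtain ⟨m, hm, _⟩ := (hmatW w _).1 (Or.inl ⟨hp, hn, rfl⟩)
    exact ⟨_, hm, rfl⟩

end Ident

end Rep

/-! ### The expected progress of the maximal matching procedure -/

theorem card_filter_mod {R b y : ℕ} (hb : 0 < b) (hR : b ∣ R) (hy : y < b) :
    ((Finset.univ : Finset (Fin R)).filter fun x : Fin R => (x : ℕ) % b = y).card * b = R := by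
  have h1 : ((Finset.univ : Finset (Fin R)).filter fun x : Fin R => (x : ℕ) % b = y).card =
      R.count (· ≡ y [MOD b]) := by
    rw [Nat.count_eq_card_filter_range, Finset.card_filter, Finset.card_filter,
      ← Fin.sum_univ_eq_sum_range (fun x => if x ≡ y [MOD b] then 1 else 0)]
    simp only [Nat.ModEq, Nat.mod_eq_of_lt hy]
  rw [h1, Nat.count_modEq_card _ hb]
  simp [Nat.mod_eq_zero_of_dvd hR, Nat.div_mul_cancel hR]

/-- The random numbers for which `o` is picked. -/
def pickSet (R : ℕ) (s : Loc) (o : Option ℕ) : Finset (Fin R) :=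
  Finset.univ.filter fun x => pickOf s x = o

theorem mem_pickSet {R : ℕ} {s : Loc} {o : Option ℕ} {x : Fin R} :
    x ∈ pickSet R s o ↔ pickOf s x = o := by
  simp [pickSet]

theorem card_pickSet_some {R : ℕ} {s : Loc} {i : ℕ} (hi : i ∈ s.resid)
    (hR : 2 * s.resid.card ∣ R) : (pickSet R s (some i)).card * (2 * s.resid.card) = R := by
  have hd : 0 < s.resid.card := Finset.card_pos.2 ⟨i, hi⟩
  obtain ⟨y, hy, hyi⟩ := List.mem_iff_getElem.1 ((Finset.mem_sort (· ≤ ·)).2 hi)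
  have hlen : y < s.resid.card := by simpa using hy
  have hf : pickSet R s (some i) =
      Finset.univ.filter fun x : Fin R => (x : ℕ) % (2 * s.resid.card) = y := by
    refine Finset.filter_congr fun x _ => ?_
    rw [pickOf, ← hyi, List.getElem?_eq_some_iff]
    constructor
    · rintro ⟨h, he⟩
      exact (Finset.sort_nodup s.resid (· ≤ ·)).getElem_inj_iff.1 he
    · intro h
      refine ⟨by rw [h]; exact hy, ?_⟩
      simp only [h]
  rw [hf, card_filter_mod (Nat.mul_pos two_pos hd) hR (by omega)]

theorem card_pickSet_none {R : ℕ} {s : Loc} (hd : 0 < s.resid.card)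
    (hR : 2 * s.resid.card ∣ R) : (pickSet R s none).card * 2 = R := by
  have h2 := Finset.card_add_card_compl (pickSet R s none)
  have h1 : (pickSet R s none)ᶜ.card * 2 = R := by
    -- The `d` disjoint events of picking a given neighbour have `R / (2d)` elements each, together
    -- half of all values.
    have hu : (pickSet R s none)ᶜ = s.resid.biUnion fun i => pickSet R s (some i) := by
      ext x
      simp only [Finset.mem_compl, Finset.mem_biUnion, mem_pickSet]
      constructor
      · intro hx
        obtain ⟨i, hi⟩ := Option.ne_none_iff_exists'.1 hx
        exact ⟨i, mem_of_pickOf hi, hi⟩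
      · rintro ⟨i, _, hx⟩
        rw [hx]
        exact Option.some_ne_none i
    have h3 : ∀ i ∈ s.resid, (pickSet R s (some i)).card = R / (2 * s.resid.card) :=
      fun i hi => (Nat.div_eq_of_eq_mul_left (by omega) (card_pickSet_some hi hR).symm).symm
    rw [hu, Finset.card_biUnion, Finset.sum_congr rfl h3, Finset.sum_const, smul_eq_mul]
    · obtain ⟨q, rfl⟩ := hR
      rw [Nat.mul_div_cancel_left _ (by omega)]
      ring
    · intro i _ j _ hij
      refine Finset.disjoint_left.2 fun x hx hx' => ?_
      rw [mem_pickSet] at hx hx'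
      exact hij (Option.some_injective _ (hx.symm.trans hx'))
  rw [Fintype.card_fin] at h2
  omega

theorem half_le_one_sub_exp_neg {s : ℝ} (h0 : 0 ≤ s) (h1 : s ≤ 1) :
    s / 2 ≤ 1 - Real.exp (-s) := by
  have h2 : Real.exp (-s) ≤ (1 + s)⁻¹ := by
    rw [Real.exp_neg]
    exact inv_anti₀ (by linarith) (by linarith [Real.add_one_le_exp s])
  have h3 : (1 + s)⁻¹ ≤ 1 - s / 2 := by
    rw [inv_le_iff_one_le_mul₀ (by linarith)]
    nlinarith
  linarith

/-! ### The probability that a processor is hit -/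

section Probability

variable {X Y : Type*} [Fintype X] [Fintype Y] [DecidableEq X] [DecidableEq Y]

variable {ident : Y ⊕ X → ℕ} {σ : Y ⊕ X → Loc}

/-- The neighbours of `v` in the residual graph. -/
def resNbrs (ident : Y ⊕ X → ℕ) (σ : Y ⊕ X → Loc) (v : Y ⊕ X) : Finset (Y ⊕ X) :=
  Finset.univ.filter fun u => ident u ∈ (σ v).resid

/-- A lower bound for the probability that `r v ∈ a` and `r u ∉ b u` for some `u ≠ v`. -/
theorem card_mem_and_exists_notMem {V : Type*} [Fintype V] [DecidableEq V] {R : ℕ} (v : V) (a : Finset (Fin R))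
    (b : V → Finset (Fin R)) (A : Finset V) (hvA : v ∉ A) (x : ℝ) (hx : 0 ≤ x)
    (ha : (a.card : ℝ) = R / 2) (hb : ∀ u ∈ A, ((b u).card : ℝ) ≤ R * (1 - x))
    (hA : A.card * x ≤ 1) (B : Finset (V → Fin R))
    (hB : ∀ r : V → Fin R, r v ∈ a → (∃ u ≠ v, r u ∉ b u) → r ∈ B) :
    A.card * x / 4 * (Fintype.card (V → Fin R) : ℝ) ≤ (B.card : ℝ) := by
  -- The event contains the difference of two boxes: `t'` constrains only `v`, while `t` also keeps
  -- every other `u` inside `b u`. The size of a box is a product, and `1 - x ≤ exp (-x)` bounds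
  -- each factor with `u ∈ A`.
  set t : V → Finset (Fin R) := Function.update b v a with ht
  set t' : V → Finset (Fin R) := Function.update (fun _ => Finset.univ) v a with ht'
  have htv : t v = a := Function.update_self ..
  have htv' : t' v = a := Function.update_self ..
  have htu : ∀ u ≠ v, t u = b u := fun u hu => Function.update_of_ne hu ..
  have htu' : ∀ u ≠ v, t' u = Finset.univ := fun u hu => Function.update_of_ne hu ..
  have hsub : Fintype.piFinset t' \ Fintype.piFinset t ⊆ B := by
    intro r hr
    rw [Finset.mem_sdiff, Fintype.mem_piFinset, Fintype.mem_piFinset, not_forall] at hr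
    obtain ⟨hr1, u, hu⟩ := hr
    have hv := htv' ▸ hr1 v
    have huv : u ≠ v := by
      rintro rfl
      rw [htv] at hu
      exact hu hv
    rw [htu u huv] at hu
    exact hB r hv ⟨u, huv, hu⟩
  have hcard := (Finset.le_card_sdiff (Fintype.piFinset t) (Fintype.piFinset t')).trans
    (Finset.card_le_card hsub)
  rw [Nat.sub_le_iff_le_add] at hcard
  have hcard' : ((Fintype.piFinset t').card : ℝ) ≤ _ := Nat.cast_le.2 hcard
  rw [Nat.cast_add] at hcard'
  set S : ℝ := ∏ _u ∈ Finset.univ.erase v, (R : ℝ) with hS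
  have hSpos : 0 ≤ S := Finset.prod_nonneg fun _ _ => Nat.cast_nonneg R
  have hcv : (Fintype.card (V → Fin R) : ℝ) = R * S := by
    rw [hS, Finset.mul_prod_erase _ (fun _ => (R : ℝ)) (Finset.mem_univ v)]
    simp
  have hc1 : ((Fintype.piFinset t').card : ℝ) = R / 2 * S := by
    rw [Fintype.card_piFinset, Nat.cast_prod,
      ← Finset.mul_prod_erase _ _ (Finset.mem_univ v), htv', ha]
    congr 1
    refine Finset.prod_congr rfl fun u hu => ?_
    rw [htu' u (Finset.ne_of_mem_erase hu), Finset.card_univ, Fintype.card_fin]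
  have hsum : ∑ u ∈ Finset.univ.erase v, (if u ∈ A then x else 0) = A.card * x := by
    rw [Finset.sum_ite_mem, Finset.sum_const, nsmul_eq_mul]
    congr 3
    ext u
    simp only [Finset.mem_inter, Finset.mem_erase, Finset.mem_univ, and_true, and_iff_right_iff_imp]
    rintro hu rfl
    exact hvA hu
  have hc2 : ((Fintype.piFinset t).card : ℝ) ≤ R / 2 * (S * Real.exp (-(A.card * x))) := by
    rw [Fintype.card_piFinset, Nat.cast_prod,
      ← Finset.mul_prod_erase _ _ (Finset.mem_univ v), htv, ha, ← hsum,
      ← Finset.sum_neg_distrib, Real.exp_sum, hS, ← Finset.prod_mul_distrib]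
    refine mul_le_mul_of_nonneg_left (Finset.prod_le_prod (fun _ _ => Nat.cast_nonneg _)
      fun u hu => ?_) (by positivity)
    rw [htu u (Finset.ne_of_mem_erase hu)]
    split_ifs with huA
    · refine (hb u huA).trans (mul_le_mul_of_nonneg_left ?_ (Nat.cast_nonneg R))
      linarith [Real.add_one_le_exp (-x)]
    · rw [neg_zero, Real.exp_zero, mul_one]
      have := Finset.card_le_univ (b u)
      rw [Fintype.card_fin] at this
      exact_mod_cast this
  have hexp := half_le_one_sub_exp_neg (mul_nonneg (Nat.cast_nonneg A.card) hx) hA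
  rw [hcv]
  rw [hc1] at hcard'
  clear_value S
  have h1 := mul_le_mul_of_nonneg_left hexp (by positivity : 0 ≤ (R : ℝ) / 2 * S)
  linarith

open Classical in
/-- A processor is hit with a probability that is at least proportional to the fraction of its
residual neighbours whose degree is not larger. -/
theorem card_hit (hirr : ∀ v, ident v ∉ (σ v).resid)
    (hsymm : ∀ u v, ident u ∈ (σ v).resid → ident v ∈ (σ u).resid)
    {R : ℕ} (hdvd : ∀ u, 0 < (σ u).resid.card → 2 * (σ u).resid.card ∣ R) (v : Y ⊕ X)
    (hle : (resNbrs ident σ v).card ≤ (σ v).resid.card) :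
    (((resNbrs ident σ v).filter fun u => (σ u).resid.card ≤ (σ v).resid.card).card : ℝ) / 8 *
        (Fintype.card (Y ⊕ X → Fin R) : ℝ) ≤
      ((σ v).resid.card : ℝ) * ((Finset.univ.filter fun r : Y ⊕ X → Fin R =>
        Hit ident σ (fun u => r u) v).card : ℝ) := by
  set A := (resNbrs ident σ v).filter fun u => (σ u).resid.card ≤ (σ v).resid.card with hA
  have hAle : A.card ≤ (σ v).resid.card := (Finset.card_filter_le _ _).trans hle
  have hvA : v ∉ A := fun h => hirr v (Finset.mem_filter.1 (Finset.mem_filter.1 h).1).2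
  obtain ⟨d, hd⟩ : ∃ d, d = (σ v).resid.card := ⟨_, rfl⟩
  rw [← hd] at hAle ⊢
  rcases d.eq_zero_or_pos with hd0 | hdpos
  · have : A.card = 0 := by omega
    rw [this, hd0]
    simp
  have hdpos' : (0 : ℝ) < d := by exact_mod_cast hdpos
  have hAle' : (A.card : ℝ) ≤ d := by exact_mod_cast hAle
  -- A neighbour of degree `d' ≤ d` picks `v` with probability `1/(2d') ≥ 1/(2d)`.
  have hb : ∀ u ∈ A, ((pickSet R (σ u) (some (ident v)))ᶜ.card : ℝ) ≤
      R * (1 - (2 * (d : ℝ))⁻¹) := by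
    intro u huA
    obtain ⟨hu1, hu2⟩ := Finset.mem_filter.1 huA
    have hvu := hsymm u v (Finset.mem_filter.1 hu1).2
    have hdu : 0 < (σ u).resid.card := Finset.card_pos.2 ⟨_, hvu⟩
    have h2 := card_pickSet_some hvu (hdvd u hdu)
    have h3 := Finset.card_add_card_compl (pickSet R (σ u) (some (ident v)))
    rw [Fintype.card_fin] at h3
    rw [← hd] at hu2
    generalize (σ u).resid.card = d' at h2 hu2 hdu
    generalize (pickSet R (σ u) (some (ident v))).card = c at h2 h3
    generalize (pickSet R (σ u) (some (ident v)))ᶜ.card = c' at h3 ⊢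
    have h4 : R ≤ c * (2 * d) := by
      rw [← h2]
      gcongr
    have h4' : (R : ℝ) ≤ c * (2 * d) := by exact_mod_cast h4
    have h3' : (c : ℝ) + c' = R := by exact_mod_cast h3
    have h5 : (R : ℝ) * (2 * (d : ℝ))⁻¹ ≤ c := by
      rw [← div_eq_mul_inv, div_le_iff₀ (by positivity)]
      exact h4'
    linarith
  have ha : ((pickSet R (σ v) none).card : ℝ) = R / 2 := by
    have : ((pickSet R (σ v) none).card : ℝ) * 2 = R := by
      exact_mod_cast card_pickSet_none (hd ▸ hdpos) (hdvd v (hd ▸ hdpos))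
    linarith
  have hAx : (A.card : ℝ) * (2 * (d : ℝ))⁻¹ ≤ 1 := by
    rw [← div_eq_mul_inv, div_le_one (by positivity)]
    linarith
  have key := card_mem_and_exists_notMem v (pickSet R (σ v) none)
    (fun u => (pickSet R (σ u) (some (ident v)))ᶜ) A hvA _ (by positivity) ha hb hAx
    (Finset.univ.filter fun r : Y ⊕ X → Fin R => Hit ident σ (fun u => r u) v) (by
      rintro r h1 ⟨u, _, h2⟩
      rw [Finset.mem_compl, not_not] at h2
      exact Finset.mem_filter.2 ⟨Finset.mem_univ _, mem_pickSet.1 h1, u, mem_pickSet.1 h2⟩)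
  refine le_trans (le_of_eq ?_) (mul_le_mul_of_nonneg_left key hdpos'.le)
  generalize (Fintype.card (Y ⊕ X → Fin R) : ℝ) = z
  field_simp
  ring

open Classical in
/-- In expectation, the hit processors have at least one eighth of the residual edges. -/
theorem sum_hit (hi : Function.Injective ident) (hirr : ∀ v, ident v ∉ (σ v).resid)
    (hsymm : ∀ u v, ident u ∈ (σ v).resid → ident v ∈ (σ u).resid)
    (htyped : ∀ v, ∀ i ∈ (σ v).resid, ∃ u, ident u = i)
    {R : ℕ}
    (hdvd : ∀ u, 0 < (σ u).resid.card → 2 * (σ u).resid.card ∣ R) :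
    ((∑ v, (σ v).resid.card : ℕ) : ℝ) / 16 *
        (Fintype.card (Y ⊕ X → Fin R) : ℝ) ≤
      ∑ r : Y ⊕ X → Fin R, ∑ v,
        if Hit ident σ (fun u => r u) v then ((σ v).resid.card : ℝ) else 0 := by
  have hcard : ∀ v, (resNbrs ident σ v).card = (σ v).resid.card := by
    intro v
    rw [← Finset.card_image_of_injective (resNbrs ident σ v) hi]
    congr 1
    ext i
    simp only [resNbrs, Finset.mem_image, Finset.mem_filter, Finset.mem_univ, true_and]
    constructor
    · rintro ⟨u, hu, rfl⟩
      exact hu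
    · intro hiv
      obtain ⟨u, rfl⟩ := htyped v i hiv
      exact ⟨u, hiv, rfl⟩
  -- At least one end of each residual edge has degree no smaller than the other end. Exchanging the
  -- ends shows that at least half of the ordered pairs are counted.
  have hpairs : ∑ v, (σ v).resid.card ≤ 2 * ∑ v, ((resNbrs ident σ v).filter
      fun u => (σ u).resid.card ≤ (σ v).resid.card).card := by
    have h1 : ∑ v, ((resNbrs ident σ v).filter
        fun u => (σ v).resid.card ≤ (σ u).resid.card).card = ∑ v, ((resNbrs ident σ v).filter
        fun u => (σ u).resid.card ≤ (σ v).resid.card).card := by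
      simp only [resNbrs, Finset.filter_filter, Finset.card_filter]
      rw [Finset.sum_comm]
      refine Finset.sum_congr rfl fun u _ => Finset.sum_congr rfl fun v _ => ?_
      have : ident u ∈ (σ v).resid ↔ ident v ∈ (σ u).resid := ⟨hsymm u v, hsymm v u⟩
      simp only [this]
    rw [two_mul]
    nth_rewrite 1 [← h1]
    rw [← Finset.sum_add_distrib]
    refine Finset.sum_le_sum fun v _ => ?_
    rw [← hcard v]
    refine (Finset.card_le_card fun u hu => ?_).trans (Finset.card_union_le _ _)
    rcases le_total (σ v).resid.card (σ u).resid.card with h | h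
    · exact Finset.mem_union_left _ (Finset.mem_filter.2 ⟨hu, by rwa [hcard]⟩)
    · exact Finset.mem_union_right _ (Finset.mem_filter.2 ⟨hu, by rwa [hcard]⟩)
  rw [Finset.sum_comm]
  have hpairs' : ((∑ v, (σ v).resid.card : ℕ) : ℝ) ≤ 2 * ∑ v, (((resNbrs ident σ v).filter
      fun u => (σ u).resid.card ≤ (σ v).resid.card).card : ℝ) := by exact_mod_cast hpairs
  calc _ ≤ (2 * ∑ v, (((resNbrs ident σ v).filter
      fun u => (σ u).resid.card ≤ (σ v).resid.card).card : ℝ)) / 16 *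
        (Fintype.card (Y ⊕ X → Fin R) : ℝ) := by gcongr
    _ = ∑ v, (((resNbrs ident σ v).filter
        fun u => (σ u).resid.card ≤ (σ v).resid.card).card : ℝ) / 8 *
        (Fintype.card (Y ⊕ X → Fin R) : ℝ) := by
        rw [← Finset.sum_mul, ← Finset.sum_div]
        ring
    _ ≤ _ := by
        refine Finset.sum_le_sum fun v _ => ?_
        refine (card_hit hirr hsymm hdvd v (hcard v).le).trans_eq ?_
        rw [← Finset.sum_filter, Finset.sum_const, nsmul_eq_mul, mul_comm]

end Probability

section Bounds

variable {X Y : Type*} [Fintype X] [Fintype Y] [DecidableEq X] [DecidableEq Y]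

variable {k : ℕ} {P : Preferences X Y} {ident : Y ⊕ X → ℕ} {N : ℕ}
  {σ : Y ⊕ X → Loc} {G G₀ : Core X Y} {E : Finset (Y × X)}

/-! ### Expected number of residual edges and of lost edges -/

theorem Rep.card_resid_man (hi : Function.Injective ident) (h : Rep ident σ G) (m : Y) :
    (σ (Sum.inl m)).resid.card = (G.res.filter fun e => e.1 = m).card := by
  rw [← Finset.card_image_of_injOn (s := G.res.filter fun e => e.1 = m)
    (f := fun e => ident (Sum.inr e.2))]
  · congr 1
    ext i
    rw [h.resM, Finset.mem_image]
    constructor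
    · rintro ⟨w, hw, rfl⟩
      exact ⟨(m, w), Finset.mem_filter.2 ⟨hw, rfl⟩, rfl⟩
    · rintro ⟨⟨m', w⟩, hw', rfl⟩
      obtain rfl : m' = m := (Finset.mem_filter.1 hw').2
      exact ⟨w, (Finset.mem_filter.1 hw').1, rfl⟩
  · intro e he f hf hef
    rw [Finset.mem_coe, Finset.mem_filter] at he hf
    exact Prod.ext (he.2.trans hf.2.symm) (Sum.inr_injective (hi hef))

theorem Rep.card_resid_woman (hi : Function.Injective ident) (h : Rep ident σ G) (w : X) :
    (σ (Sum.inr w)).resid.card = (G.res.filter fun e => e.2 = w).card := by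
  rw [← Finset.card_image_of_injOn (s := G.res.filter fun e => e.2 = w)
    (f := fun e => ident (Sum.inl e.1))]
  · congr 1
    ext i
    rw [h.resW, Finset.mem_image]
    constructor
    · rintro ⟨m, hm, rfl⟩
      exact ⟨(m, w), Finset.mem_filter.2 ⟨hm, rfl⟩, rfl⟩
    · rintro ⟨⟨m, w'⟩, hm', rfl⟩
      obtain rfl : w' = w := (Finset.mem_filter.1 hm').2
      exact ⟨m, (Finset.mem_filter.1 hm').1, rfl⟩
  · intro e he f hf hef
    rw [Finset.mem_coe, Finset.mem_filter] at he hf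
    exact Prod.ext (Sum.inl_injective (hi hef)) (he.2.trans hf.2.symm)

theorem Rep.sum_card_resid (hi : Function.Injective ident) (h : Rep ident σ G) :
    ∑ v, (σ v).resid.card = 2 * G.res.card := by
  rw [Fintype.sum_sum_type]
  simp only [h.card_resid_man hi, h.card_resid_woman hi]
  rw [← Finset.card_eq_sum_card_fiberwise (fun _ _ => Finset.mem_coe.2 (Finset.mem_univ _)),
    ← Finset.card_eq_sum_card_fiberwise (fun _ _ => Finset.mem_coe.2 (Finset.mem_univ _)), two_mul]

open Classical in
/-- The edges of the processors that are hit disappear from the residual graph. -/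
theorem Rep.card_iter_res (hi : Function.Injective ident) (h : Rep ident σ G) {r : Y ⊕ X → ℕ}
    {qw : Y × X → ℕ} {μ : Finset (Y × X)}
    (hM : ∀ m, Hit ident σ r (Sum.inl m) → ∃ f ∈ μ, f.1 = m)
    (hW : ∀ w, Hit ident σ r (Sum.inr w) → ∃ f ∈ μ, f.2 = w) :
    2 * (G.iter qw μ).res.card + (∑ v, if Hit ident σ r v then (σ v).resid.card else 0) ≤
      2 * G.res.card := by
  have hsub : (G.iter qw μ).res ⊆ G.res := fun e he => (Core.mem_iter_res.1 he).1
  have hc := Finset.card_sdiff_add_card_eq_card hsub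
  -- A vanishing edge is counted at most once among the men and once among the women, hence the
  -- factor two.
  have h1 : ∑ m : Y, (if Hit ident σ r (Sum.inl m) then (σ (Sum.inl m)).resid.card else 0) ≤
      (G.res \ (G.iter qw μ).res).card := by
    rw [Finset.card_eq_sum_card_fiberwise (f := Prod.fst) (t := Finset.univ)
      (fun _ _ => Finset.mem_coe.2 (Finset.mem_univ _))]
    refine Finset.sum_le_sum fun m _ => ?_
    split_ifs with hm
    · rw [h.card_resid_man hi]
      obtain ⟨f, hf, hfm⟩ := hM m hm
      refine Finset.card_le_card fun e he => ?_
      rw [Finset.mem_filter] at he ⊢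
      refine ⟨Finset.mem_sdiff.2 ⟨he.1, fun he' => ?_⟩, he.2⟩
      exact ((Core.mem_iter_res.1 he').2 f hf).1 (hfm.trans he.2.symm)
    · exact Nat.zero_le _
  have h2 : ∑ w : X, (if Hit ident σ r (Sum.inr w) then (σ (Sum.inr w)).resid.card else 0) ≤
      (G.res \ (G.iter qw μ).res).card := by
    rw [Finset.card_eq_sum_card_fiberwise (f := Prod.snd) (t := Finset.univ)
      (fun _ _ => Finset.mem_coe.2 (Finset.mem_univ _))]
    refine Finset.sum_le_sum fun w _ => ?_
    split_ifs with hw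
    · rw [h.card_resid_woman hi]
      obtain ⟨f, hf, hfw⟩ := hW w hw
      refine Finset.card_le_card fun e he => ?_
      rw [Finset.mem_filter] at he ⊢
      refine ⟨Finset.mem_sdiff.2 ⟨he.1, fun he' => ?_⟩, he.2⟩
      exact ((Core.mem_iter_res.1 he').2 f hf).2 (hfw.trans he.2.symm)
    · exact Nat.zero_le _
  rw [Fintype.sum_sum_type]
  omega

theorem quantile_lt {ι : Type*} [DecidableEq ι] {k : ℕ} (hk : 0 < k) {l : List ι} {a : ι}
    (ha : a ∈ l) : quantile k l a < k := by
  have := List.idxOf_lt_length_iff.2 ha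
  exact Nat.div_lt_of_lt_mul (Nat.mul_lt_mul_of_pos_right this hk)

/-- The setting in which the algorithm is analysed. -/
structure Setting (k : ℕ) (P : Preferences X Y) (ident : Y ⊕ X → ℕ) (N : ℕ)
    (E : Finset (Y × X)) : Prop where
  pos : 0 < k
  inj : Function.Injective ident
  mem : ∀ e, e ∈ E ↔ e.2 ∈ P.ofMan e.1
  card_women : Fintype.card X ≤ N
  card_men : Fintype.card Y ≤ N

/-! ### Bounds in expectation, propagated backwards through the program -/

namespace Setting

theorem quantM_lt (hs : Setting k P ident N E) : ∀ e ∈ E, quantM k P e < k :=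
  fun e he => quantile_lt hs.pos ((hs.mem e).1 he)

theorem quantW_lt (hs : Setting k P ident N E) : ∀ e ∈ E, quantW k P e < k :=
  fun e he => quantile_lt hs.pos ((P.symmetric _ _).2 ((hs.mem e).1 he))

open Classical in
/-- In expectation, a sixteenth of the residual edges disappears in an iteration. -/
theorem sum_card_iter_res (hs : Setting k P ident N E) (h : Rep ident σ G) (qw : Y × X → ℕ)
    (μ : (Y ⊕ X → Fin (2 * N.factorial)) → Finset (Y × X))
    (hM : ∀ r m, Hit ident σ (fun u => r u) (Sum.inl m) → ∃ f ∈ μ r, f.1 = m)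
    (hW : ∀ r w, Hit ident σ (fun u => r u) (Sum.inr w) → ∃ f ∈ μ r, f.2 = w) :
    ∑ r, ((G.iter qw (μ r)).res.card : ℝ) ≤
      15 / 16 * G.res.card * (Fintype.card (Y ⊕ X → Fin (2 * N.factorial)) : ℝ) := by
  have hirr : ∀ v, ident v ∉ (σ v).resid := by
    rintro (m | w) hv
    · obtain ⟨w, _, hw⟩ := (h.resM m _).1 hv
      exact absurd (hs.inj hw) (by simp)
    · obtain ⟨m, _, hm⟩ := (h.resW w _).1 hv
      exact absurd (hs.inj hm) (by simp)
  have htyped : ∀ v, ∀ i ∈ (σ v).resid, ∃ u, ident u = i := by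
    rintro (m | w) i hv
    · obtain ⟨w, _, hw⟩ := (h.resM m _).1 hv
      exact ⟨_, hw⟩
    · obtain ⟨m, _, hm⟩ := (h.resW w _).1 hv
      exact ⟨_, hm⟩
  have hsymm : ∀ u v, ident u ∈ (σ v).resid → ident v ∈ (σ u).resid := by
    rintro u (m | w) hv
    · obtain ⟨w, hw, he⟩ := (h.resM m _).1 hv
      obtain rfl := hs.inj he
      exact (h.resW w _).2 ⟨m, hw, rfl⟩
    · obtain ⟨m, hm, he⟩ := (h.resW w _).1 hv
      obtain rfl := hs.inj he
      exact (h.resM m _).2 ⟨w, hm, rfl⟩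
  have hN : ∀ v, (σ v).resid.card ≤ N := by
    rintro (m | w)
    · refine le_trans ?_ hs.card_women
      rw [h.card_resid_man hs.inj, ← Finset.card_image_of_injOn (f := Prod.snd)]
      · exact Finset.card_le_univ _
      · intro e he f hf hef
        rw [Finset.mem_coe, Finset.mem_filter] at he hf
        exact Prod.ext (he.2.trans hf.2.symm) hef
    · refine le_trans ?_ hs.card_men
      rw [h.card_resid_woman hs.inj, ← Finset.card_image_of_injOn (f := Prod.fst)]
      · exact Finset.card_le_univ _
      · intro e he f hf hef
        rw [Finset.mem_coe, Finset.mem_filter] at he hf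
        exact Prod.ext hef (he.2.trans hf.2.symm)
  have key := sum_hit hs.inj hirr hsymm htyped (R := 2 * N.factorial)
    fun u hu => Nat.mul_dvd_mul_left 2 (Nat.dvd_factorial hu (hN u))
  rw [h.sum_card_resid hs.inj] at key
  generalize 2 * N.factorial = R at μ hM hW key ⊢
  have h1 : ∀ r : Y ⊕ X → Fin R, 2 * ((G.iter qw (μ r)).res.card : ℝ) +
      (∑ v, if Hit ident σ (fun u => r u) v then ((σ v).resid.card : ℝ) else 0) ≤
      2 * (G.res.card : ℝ) := by
    intro r
    exact_mod_cast h.card_iter_res hs.inj (qw := qw) (hM r) (hW r)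
  have h2 := Finset.sum_le_sum fun (r : Y ⊕ X → Fin R) (_ : r ∈ Finset.univ) => h1 r
  rw [Finset.sum_add_distrib, ← Finset.mul_sum, Finset.sum_const, nsmul_eq_mul,
    Finset.card_univ] at h2
  push_cast at key
  linarith

/-- The expectation of `f` after the instructions `p`, from a state with the property `Pre`, is
bounded in terms of the numbers of lost and residual edges. -/
def Bounded (k : ℕ) (P : Preferences X Y) (ident : Y ⊕ X → ℕ) (N : ℕ) (E : Finset (Y × X))
    (f : (Y ⊕ X → Loc) → ℝ) (A : ℝ) (p : List Instr) (Pre : Core X Y → Prop) (c b : ℝ) : Prop :=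
  ∀ (σ : Y ⊕ X → Loc) (G : Core X Y), Rep ident σ G → G.Inv (quantM k P) (quantW k P) E → Pre G →
    expect k P ident N (2 * N.factorial) p σ f ≤
      A * (G.lost (quantW k P) E).card + c * G.res.card + b

variable {f : (Y ⊕ X → Loc) → ℝ} {A : ℝ} {q : List Instr} {Pre Pre' : Core X Y → Prop} {b c : ℝ}

theorem factorial_pos' : 0 < 2 * N.factorial := Nat.mul_pos two_pos N.factorial_pos

theorem expect_iterProg (σ : Y ⊕ X → Loc) :
    expect k P ident N (2 * N.factorial) (iterProg ++ q) σ f =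
      (∑ r : Y ⊕ X → Fin (2 * N.factorial),
        expect k P ident N (2 * N.factorial) q (iterStep k P ident N σ fun v => r v) f) /
        (Fintype.card (Y ⊕ X → Fin (2 * N.factorial)) : ℝ) := by
  simp only [iterProg, List.cons_append, List.nil_append]
  rw [expect]
  congr 1
  refine Finset.sum_congr rfl fun r _ => ?_
  rw [expect_cons_of_forall factorial_pos' (fun _ => rfl),
    expect_cons_of_forall factorial_pos' (fun _ => rfl),
    expect_cons_of_forall factorial_pos' (fun _ => rfl)]
  rfl

/-- A bound linear in the number of residual edges survives averaging. The lost edges do not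
increase, so only the coefficient `c` changes. -/
theorem bounded_iter (hs : Setting k P ident N E) (hA : 0 ≤ A) (hc : 0 ≤ c)
    (hq : Bounded k P ident N E f A q Pre c b)
    (hPre : ∀ G μ, G.Inv (quantM k P) (quantW k P) E → μ ⊆ G.res → Disj μ → Pre G →
      Pre (G.iter (quantW k P) μ)) :
    Bounded k P ident N E f A (iterProg ++ q) Pre (15 / 16 * c) b := by
  intro σ G h hG hpre
  have : NeZero (2 * N.factorial) := ⟨factorial_pos'.ne'⟩
  rw [expect_iterProg]
  choose μ hμ hd hrep hM hW using fun r : Y ⊕ X → Fin (2 * N.factorial) =>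
    h.iter (k := k) (N := N) hs.inj hG (fun e he => (hs.mem e).1 he) fun v => (r v : ℕ)
  have key := hs.sum_card_iter_res h (quantW k P) μ hM hW
  have hcard : (0 : ℝ) < Fintype.card (Y ⊕ X → Fin (2 * N.factorial)) := by
    exact_mod_cast Fintype.card_pos
  rw [div_le_iff₀ hcard]
  have h1 : ∀ r : Y ⊕ X → Fin (2 * N.factorial),
      expect k P ident N (2 * N.factorial) q (iterStep k P ident N σ fun v => r v) f ≤
        A * (G.lost (quantW k P) E).card + c * (G.iter (quantW k P) (μ r)).res.card + b := by
    intro r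
    refine (hq _ _ (hrep r) (hG.iter (hμ r) (hd r)) (hPre G _ hG (hμ r) (hd r) hpre)).trans ?_
    have := Finset.card_le_card (hG.lost_iter (hμ r))
    gcongr
  generalize 2 * N.factorial = R at *
  refine (Finset.sum_le_sum fun r _ => h1 r).trans ?_
  rw [Finset.sum_add_distrib, Finset.sum_add_distrib, Finset.sum_const,
    Finset.sum_const, nsmul_eq_mul, nsmul_eq_mul, Finset.card_univ, ← Finset.mul_sum]
  have := mul_le_mul_of_nonneg_left key hc
  linarith

theorem bounded_match (hs : Setting k P ident N E) (hA : 0 ≤ A) (hc : 0 ≤ c)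
    (hq : Bounded k P ident N E f A q Pre c b)
    (hPre : ∀ G μ, G.Inv (quantM k P) (quantW k P) E → μ ⊆ G.res → Disj μ → Pre G →
      Pre (G.iter (quantW k P) μ)) (T : ℕ) :
    Bounded k P ident N E f A (matchProg T ++ q) Pre ((15 / 16) ^ T * c) b := by
  induction T with
  | zero => simpa [matchProg] using hq
  | succ T ih =>
    have := bounded_iter hs hA (by positivity) ih hPre
    rw [matchProg, List.append_assoc]
    rwa [pow_succ', mul_assoc]

/-- The round opens with at most `|E|` residual edges, and `clean` turns the survivors of `T`
iterations into lost edges of weight `A`. The residual coefficient is zero on both sides because no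
residual edges exist there. -/
theorem bounded_round (hs : Setting k P ident N E) (hA : 0 ≤ A) (i T : ℕ)
    (hq : Bounded k P ident N E f A q
      (fun G => Core.Call (quantW k P) k G₀ G ∧ Core.Above (quantW k P) (i + 1) G ∧ G.res = ∅) 0 b) :
    Bounded k P ident N E f A (roundProg T i ++ q)
      (fun G => Core.Call (quantW k P) k G₀ G ∧ Core.Above (quantW k P) i G ∧ G.res = ∅) 0
      (b + A * (15 / 16) ^ T * E.card) := by
  have hclean : Bounded k P ident N E f A ([.clean, .heed] ++ q)
      (fun G => Core.Call (quantW k P) k G₀ G ∧ Core.Level (quantW k P) i G) A b := by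
    intro σ G h hG hpre
    have h1 := h.clean (k := k) (N := N) hs.inj hG (fun e he => (hs.mem e).1 he)
      (fun _ => 0) fun _ => 0
    have h2 := hq _ _ h1 hG.clean ⟨hpre.1.clean, hpre.2.clean, rfl⟩
    simp only [List.cons_append, List.nil_append]
    rw [expect_cons_of_forall factorial_pos' (fun _ => rfl),
      expect_cons_of_forall factorial_pos' (fun _ => rfl)]
    refine h2.trans ?_
    have h3 : ((G.clean.lost (quantW k P) E).card : ℝ) ≤
        (G.lost (quantW k P) E).card + G.res.card := by
      exact_mod_cast (Finset.card_le_card Core.lost_clean).trans (Finset.card_union_le _ _)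
    have := mul_le_mul_of_nonneg_left h3 hA
    linarith
  have hmatch := bounded_match hs hA hA hclean (fun G μ hG hμ hd hpre =>
    ⟨hpre.1.iter hG hs.quantW_lt hμ hd, hpre.2.iter hG hμ⟩) T
  intro σ G h hG hpre
  have h1 := h.offer (k := k) (N := N) hs.inj (fun e he => (hs.mem e).1 (hG.live_sub he)) i
    (fun _ => 0) (fun _ => 0) fun _ => 0
  have h2 := hmatch _ _ h1 hG.offer ⟨hpre.1.offer, hpre.2.1.offer⟩
  simp only [roundProg, List.cons_append, List.nil_append, List.append_assoc]
  simp only [List.cons_append, List.nil_append] at h2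
  rw [expect_cons_of_forall factorial_pos' (fun _ => rfl),
    expect_cons_of_forall factorial_pos' (fun _ => rfl),
    expect_cons_of_forall factorial_pos' (fun _ => rfl)]
  refine h2.trans ?_
  have h3 : ((G.offer (quantW k P) i).res.card : ℝ) ≤ E.card := by
    exact_mod_cast Finset.card_le_card fun e he =>
      hG.live_sub (Core.mem_offer_res.1 he).1.2
  have h4 : (G.offer (quantW k P) i).lost (quantW k P) E = G.lost (quantW k P) E := rfl
  have := mul_le_mul_of_nonneg_left h3 (by positivity : (0 : ℝ) ≤ (15 / 16) ^ T * A)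
  rw [h4]
  linarith

theorem bounded_levels (hs : Setting k P ident N E) (hA : 0 ≤ A) (T : ℕ)
    (hq : Bounded k P ident N E f A q
      (fun G => Core.Call (quantW k P) k G₀ G ∧ Core.Above (quantW k P) k G ∧ G.res = ∅) 0 b)
    (j : ℕ) (hj : j ≤ k) :
    Bounded k P ident N E f A (levelsProg T k j ++ q)
      (fun G => Core.Call (quantW k P) k G₀ G ∧ Core.Above (quantW k P) (k - j) G ∧ G.res = ∅) 0
      (b + j * (A * (15 / 16) ^ T * E.card)) := by
  induction j with
  | zero => simpa [levelsProg] using hq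
  | succ j ih =>
    have h1 := ih (by omega)
    have he : k - j = k - (j + 1) + 1 := by omega
    rw [he] at h1
    have h2 := bounded_round hs hA (k - (j + 1)) T h1
    rw [levelsProg, List.append_assoc]
    push_cast
    convert h2 using 1
    ring

/-- What is known after `j` calls: the number of bad men is small. -/
def After (k : ℕ) (P : Preferences X Y) (K j : ℕ) (G : Core X Y) : Prop :=
  j * G.bad.card + (G.potW (quantW k P) k + G.potM (quantM k P)) ≤ K ∧ G.res = ∅

/-- Each call adds one copy of the number of bad men to `After`: the potential pays for those who
are bad at the beginning of the call, and those who are bad at its end are no more numerous. -/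
theorem bounded_calls (hs : Setting k P ident N E) (hA : 0 ≤ A) (T K L j : ℕ)
    (hf : Bounded k P ident N E f A [] (After k P K (j + L)) 0 0) :
    Bounded k P ident N E f A (callsProg T k L) (After k P K j) 0
      (L * (k * (A * (15 / 16) ^ T * E.card))) := by
  induction L generalizing j with
  | zero => simpa [callsProg] using hf
  | succ L ih =>
    have h1 := ih (j + 1) (by rwa [show j + 1 + L = j + (L + 1) by omega])
    intro σ G h hG hpre
    have h2 := bounded_levels (G₀ := G) hs hA T (q := callsProg T k L)
      (b := L * (k * (A * (15 / 16) ^ T * E.card))) (f := f) (fun σ' G' h' hG' hpre' => by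
        obtain ⟨hcall, habove, hres⟩ := hpre'
        refine h1 σ' G' h' hG' ⟨?_, hres⟩
        -- Quantiles are smaller than `k`, so nothing can be pending above level `k`.
        have hdone : G'.act ∩ G'.live = ∅ := by
          rw [Finset.eq_empty_iff_forall_notMem]
          intro e he
          exact absurd (hs.quantW_lt e (hG'.live_sub (Finset.mem_inter.1 he).2))
            (not_lt.2 (habove e he))
        have h3 := hcall.pot_le hG' hdone
        have h4 := hcall.card_bad_le hG hG'
        have h5 := hpre.1
        have h6 := Nat.mul_le_mul_left j h4
        rw [add_mul, one_mul]
        omega) k le_rfl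
    rw [callsProg, expect_cons_of_forall factorial_pos' (fun _ => rfl)]
    refine (h2 _ _ (h.reset hs.inj _) (hG.reset hpre.2)
      ⟨Core.call_reset k, fun e he => by omega, hpre.2⟩).trans ?_
    have h7 : (G.reset (quantM k P)).lost (quantW k P) E = G.lost (quantW k P) E := rfl
    rw [h7]
    push_cast
    linarith

end Setting

end Bounds

/-! ### Counting blocking pairs -/

/-- Few entries of a list precede a given entry in its quantile. -/
theorem card_quantile_eq {ι : Type*} [DecidableEq ι] (k : ℕ) (l : List ι) (a : ι) :
    (l.toFinset.filter fun b => l.idxOf b < l.idxOf a ∧ quantile k l b = quantile k l a).card * k ≤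
      l.length := by
  set S := l.toFinset.filter fun b => l.idxOf b < l.idxOf a ∧ quantile k l b = quantile k l a
    with hS
  rcases S.eq_empty_or_nonempty with h0 | hne
  · simp [h0]
  obtain ⟨b, hb, hmin⟩ := S.exists_min_image (fun b => l.idxOf b) hne
  have hb' := Finset.mem_filter.1 hb
  -- All of `S` lies between its earliest entry `b` and `a`. Equal quotients then keep `idxOf a * k`
  -- within `l.length` of `idxOf b * k`.
  have h1 : S.card ≤ l.idxOf a - l.idxOf b := by
    rw [← Nat.card_Ico, ← Finset.card_image_of_injOn (s := S) (f := fun b => l.idxOf b)]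
    · refine Finset.card_le_card fun i hi => ?_
      obtain ⟨c, hc, rfl⟩ := Finset.mem_image.1 hi
      exact Finset.mem_Ico.2 ⟨hmin c hc, (Finset.mem_filter.1 hc).2.1⟩
    · intro c hc d _ hcd
      have hcl := List.mem_toFinset.1 (Finset.mem_filter.1 (Finset.mem_coe.1 hc)).1
      exact (List.idxOf_inj hcl).1 hcd
  have hlen : 0 < l.length := List.length_pos_of_mem (List.mem_toFinset.1 hb'.1)
  have h2 := hb'.2.2
  unfold quantile at h2
  have h3 := Nat.div_add_mod (l.idxOf b * k) l.length
  have h4 := Nat.div_add_mod (l.idxOf a * k) l.length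
  have h5 := Nat.mod_lt (l.idxOf a * k) hlen
  rw [← h2] at h4
  have h6 : l.idxOf a * k ≤ l.idxOf b * k + l.length := by omega
  calc S.card * k ≤ (l.idxOf a - l.idxOf b) * k := Nat.mul_le_mul_right k h1
    _ = l.idxOf a * k - l.idxOf b * k := Nat.sub_mul ..
    _ ≤ l.length := by omega

theorem quantile_mono {ι : Type*} [DecidableEq ι] (k : ℕ) {l : List ι} {a b : ι}
    (h : l.idxOf a < l.idxOf b) : quantile k l a ≤ quantile k l b :=
  Nat.div_le_div_right (Nat.mul_le_mul_right k h.le)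

section Final

variable {X Y : Type*} [Fintype X] [Fintype Y] [DecidableEq X] [DecidableEq Y]

variable {k : ℕ} {P : Preferences X Y} {ident : Y ⊕ X → ℕ} {N : ℕ}
  {σ : Y ⊕ X → Loc} {G : Core X Y} {E : Finset (Y × X)}

section Edges

variable (hE : ∀ e, e ∈ E ↔ e.2 ∈ P.ofMan e.1)

include hE

theorem card_edges_man (m : Y) :
    (E.filter fun e => e.1 = m).card = (P.ofMan m).length := by
  rw [← List.toFinset_card_of_nodup (P.nodup_ofMan m),
    ← Finset.card_image_of_injective (P.ofMan m).toFinset (Prod.mk_right_injective m)]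
  congr 1
  ext ⟨m', w⟩
  simp only [Finset.mem_filter, hE, Finset.mem_image, List.mem_toFinset, Prod.mk.injEq]
  constructor
  · rintro ⟨h, rfl⟩
    exact ⟨w, h, rfl, rfl⟩
  · rintro ⟨w', h, rfl, rfl⟩
    exact ⟨h, rfl⟩

theorem card_edges_woman (w : X) :
    (E.filter fun e => e.2 = w).card = (P.ofWoman w).length := by
  rw [← List.toFinset_card_of_nodup (P.nodup_ofWoman w),
    ← Finset.card_image_of_injective (P.ofWoman w).toFinset (Prod.mk_left_injective w)]
  congr 1
  ext ⟨m, w'⟩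
  simp only [Finset.mem_filter, hE, Finset.mem_image, List.mem_toFinset, Prod.mk.injEq,
    P.symmetric]
  constructor
  · rintro ⟨h, rfl⟩
    exact ⟨m, h, rfl, rfl⟩
  · rintro ⟨m', h, rfl, rfl⟩
    exact ⟨h, rfl⟩

theorem card_edges : E.card = ∑ m, (P.ofMan m).length := by
  rw [Finset.card_eq_sum_card_fiberwise (f := Prod.fst) (t := Finset.univ)
    (fun _ _ => Finset.mem_coe.2 (Finset.mem_univ _))]
  exact Finset.sum_congr rfl fun m _ => card_edges_man hE m

theorem card_edges' : E.card = ∑ w, (P.ofWoman w).length := by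
  rw [Finset.card_eq_sum_card_fiberwise (f := Prod.snd) (t := Finset.univ)
    (fun _ _ => Finset.mem_coe.2 (Finset.mem_univ _))]
  exact Finset.sum_congr rfl fun m _ => card_edges_woman hE m

/-- The edges that precede a matched edge in its quantile for the man. -/
theorem card_sameM {M : Finset (Y × X)} (hM : Disj M) :
    (E.filter fun e => ∃ f ∈ M, f.1 = e.1 ∧
      (P.ofMan e.1).idxOf e.2 < (P.ofMan f.1).idxOf f.2 ∧ quantM k P e = quantM k P f).card * k ≤
      E.card := by
  set S := E.filter fun e => ∃ f ∈ M, f.1 = e.1 ∧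
      (P.ofMan e.1).idxOf e.2 < (P.ofMan f.1).idxOf f.2 ∧ quantM k P e = quantM k P f with hS
  rw [Finset.card_eq_sum_card_fiberwise (f := Prod.fst) (t := Finset.univ)
    (fun _ _ => Finset.mem_coe.2 (Finset.mem_univ _)), card_edges hE, Finset.sum_mul]
  refine Finset.sum_le_sum fun m _ => ?_
  rcases (S.filter fun e => e.1 = m).eq_empty_or_nonempty with h0 | ⟨e₀, he₀⟩
  · simp [h0]
  obtain ⟨heS, rfl⟩ := Finset.mem_filter.1 he₀
  obtain ⟨-, ⟨m, w⟩, hf, hme, -⟩ := Finset.mem_filter.1 heS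
  obtain rfl : m = e₀.1 := hme
  refine le_trans (Nat.mul_le_mul_right k ?_) (card_quantile_eq k (P.ofMan e₀.1) w)
  rw [← Finset.card_image_of_injOn (f := Prod.snd) (s := S.filter fun e => e.1 = e₀.1)]
  · refine Finset.card_le_card fun w' hw' => ?_
    obtain ⟨e, he, rfl⟩ := Finset.mem_image.1 hw'
    obtain ⟨he, hem⟩ := Finset.mem_filter.1 he
    obtain ⟨heE, f, hf', hfe, hlt, hq⟩ := Finset.mem_filter.1 he
    have : f = (e₀.1, w) := hM f hf' _ hf (Or.inl (hfe.trans hem))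
    subst this
    rw [hE] at heE
    rw [quantM] at hq
    rw [hem] at heE hlt hq
    exact Finset.mem_filter.2 ⟨List.mem_toFinset.2 heE, hlt, hq⟩
  · intro e he f hf hef
    rw [Finset.mem_coe, Finset.mem_filter] at he hf
    exact Prod.ext (he.2.trans hf.2.symm) hef

/-- The edges that precede a matched edge in its quantile for the woman. -/
theorem card_sameW {M : Finset (Y × X)} (hM : Disj M) :
    (E.filter fun e => ∃ f ∈ M, f.2 = e.2 ∧
      (P.ofWoman e.2).idxOf e.1 < (P.ofWoman f.2).idxOf f.1 ∧
      quantW k P e = quantW k P f).card * k ≤ E.card := by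
  set S := E.filter fun e => ∃ f ∈ M, f.2 = e.2 ∧
      (P.ofWoman e.2).idxOf e.1 < (P.ofWoman f.2).idxOf f.1 ∧ quantW k P e = quantW k P f with hS
  rw [Finset.card_eq_sum_card_fiberwise (f := Prod.snd) (t := Finset.univ)
    (fun _ _ => Finset.mem_coe.2 (Finset.mem_univ _)), card_edges' hE, Finset.sum_mul]
  refine Finset.sum_le_sum fun w _ => ?_
  rcases (S.filter fun e => e.2 = w).eq_empty_or_nonempty with h0 | ⟨e₀, he₀⟩
  · simp [h0]
  obtain ⟨heS, rfl⟩ := Finset.mem_filter.1 he₀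
  obtain ⟨-, ⟨m, w⟩, hf, hwe, -⟩ := Finset.mem_filter.1 heS
  obtain rfl : w = e₀.2 := hwe
  refine le_trans (Nat.mul_le_mul_right k ?_) (card_quantile_eq k (P.ofWoman e₀.2) m)
  rw [← Finset.card_image_of_injOn (f := Prod.fst) (s := S.filter fun e => e.2 = e₀.2)]
  · refine Finset.card_le_card fun m' hm' => ?_
    obtain ⟨e, he, rfl⟩ := Finset.mem_image.1 hm'
    obtain ⟨he, hem⟩ := Finset.mem_filter.1 he
    obtain ⟨heE, f, hf', hfe, hlt, hq⟩ := Finset.mem_filter.1 he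
    have : f = (m, e₀.2) := hM f hf' _ hf (Or.inr (hfe.trans hem))
    subst this
    rw [hE, ← P.symmetric] at heE
    rw [quantW] at hq
    rw [hem] at heE hlt hq
    exact Finset.mem_filter.2 ⟨List.mem_toFinset.2 heE, hlt, hq⟩
  · intro e he f hf hef
    rw [Finset.mem_coe, Finset.mem_filter] at he hf
    exact Prod.ext hef (he.2.trans hf.2.symm)

/-- The number of edges of a set of men in almost regular preferences. -/
theorem card_edges_of_men {α : ℝ} (hα : P.IsAlmostRegular α) (S : Finset Y) :
    (Fintype.card Y : ℝ) * (E.filter fun e => e.1 ∈ S).card ≤ S.card * (α * E.card) := by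
  have h1 : (E.filter fun e => e.1 ∈ S).card = ∑ m ∈ S, (P.ofMan m).length := by
    rw [Finset.card_eq_sum_card_fiberwise (f := Prod.fst) (t := S)
      (s := E.filter fun e => e.1 ∈ S)
      (fun e he => Finset.mem_coe.2 (Finset.mem_filter.1 (Finset.mem_coe.1 he)).2)]
    refine Finset.sum_congr rfl fun m hm => ?_
    rw [← card_edges_man hE m, Finset.filter_filter]
    congr 1
    refine Finset.filter_congr fun e _ => ⟨And.right, fun h => ⟨h ▸ hm, h⟩⟩
  -- Almost regularity summed over the second man: no degree exceeds `α` times the average degree.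
  have h2 : ∀ m, (Fintype.card Y : ℝ) * (P.ofMan m).length ≤ α * E.card := by
    intro m
    rw [card_edges hE, Nat.cast_sum, Finset.mul_sum, ← nsmul_eq_mul, ← Finset.card_univ,
      ← Finset.sum_const]
    exact Finset.sum_le_sum fun m' _ => hα m m'
  rw [h1, Nat.cast_sum, Finset.mul_sum, ← nsmul_eq_mul, ← Finset.sum_const]
  exact Finset.sum_le_sum fun m _ => h2 m

/-- The number of blocking pairs in a state of the process. -/
theorem card_blockingPairs_le (hG : G.Inv (quantM k P) (quantW k P) E) :
    (P.blockingPairs (G.M : Set (Y × X))).ncard * k ≤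
      (E.filter fun e => e.1 ∈ G.bad).card * k + 2 * E.card +
        (G.lost (quantW k P) E).card * k := by
  have h1 := card_sameM (k := k) hE hG.disj
  have h2 := card_sameW (k := k) hE hG.disj
  set B := E.filter fun e => e.1 ∈ G.bad
  set S₁ := E.filter fun e => ∃ f ∈ G.M, f.1 = e.1 ∧
      (P.ofMan e.1).idxOf e.2 < (P.ofMan f.1).idxOf f.2 ∧ quantM k P e = quantM k P f
  set S₂ := E.filter fun e => ∃ f ∈ G.M, f.2 = e.2 ∧
      (P.ofWoman e.2).idxOf e.1 < (P.ofWoman f.2).idxOf f.1 ∧ quantW k P e = quantW k P f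
  have hsub : P.blockingPairs (G.M : Set (Y × X)) ⊆
      ((B ∪ S₁ ∪ S₂ ∪ G.lost (quantW k P) E : Finset (Y × X)) : Set (Y × X)) := by
    rintro ⟨m, w⟩ ⟨he, _, hm, hw⟩
    have heE : (m, w) ∈ E := (hE _).2 he
    have key := hG.blocking_subset (rm := fun e => (P.ofMan e.1).idxOf e.2)
      (rw := fun e => (P.ofWoman e.2).idxOf e.1)
      (fun e f hef hlt => by
        simp only [quantM, hef] at hlt ⊢
        exact quantile_mono k hlt)
      (fun e f hef hlt => by
        simp only [quantW, hef] at hlt ⊢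
        exact quantile_mono k hlt) heE
      (by
        rintro ⟨m', w'⟩ hf rfl
        exact hm w' hf)
      (by
        rintro ⟨m', w'⟩ hf rfl
        exact hw m' hf)
    simp only [Finset.coe_union, Set.mem_union, Finset.mem_coe]
    rcases key with h | h | h | h
    · exact Or.inl (Or.inl (Or.inl (Finset.mem_filter.2 ⟨heE, h⟩)))
    · exact Or.inl (Or.inl (Or.inr (Finset.mem_filter.2 ⟨heE, h⟩)))
    · exact Or.inl (Or.inr (Finset.mem_filter.2 ⟨heE, h⟩))
    · exact Or.inr h
  have h3 := Set.ncard_le_ncard hsub (Finset.finite_toSet _)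
  rw [Set.ncard_coe_finset] at h3
  have h4 : (B ∪ S₁ ∪ S₂ ∪ G.lost (quantW k P) E).card ≤
      B.card + S₁.card + S₂.card + (G.lost (quantW k P) E).card :=
    (Finset.card_union_le _ _).trans (Nat.add_le_add_right ((Finset.card_union_le _ _).trans
      (Nat.add_le_add_right (Finset.card_union_le _ _) _)) _)
  have h5 := Nat.mul_le_mul_right k (h3.trans h4)
  rw [add_mul, add_mul, add_mul] at h5
  omega

theorem ncard_edges : P.edges.ncard = E.card := by
  rw [← Set.ncard_coe_finset]
  congr 1
  ext e
  exact (hE e).symm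

theorem isMatching_core (hG : G.Inv (quantM k P) (quantW k P) E) :
    P.IsMatching (G.M : Set (Y × X)) :=
  ⟨fun e he => (hE e).1 (hG.live_sub (hG.sub_live he)), hG.disj⟩

/-- If few men are bad and few edges are lost, then the matching is almost stable. -/
theorem isAlmostStable_of_lost_le (hG : G.Inv (quantM k P) (quantW k P) E) {ε α : ℝ} {L : ℕ}
    (hε : 0 < ε) (hα : P.IsAlmostRegular α) (hα1 : 1 ≤ α) (hk : 8 / ε ≤ k)
    (hL : 8 * k * α / ε ≤ L)
    (hbad : L * G.bad.card ≤ 2 * k * Fintype.card Y)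
    (hlost : ((G.lost (quantW k P) E).card : ℝ) ≤ ε / 2 * E.card) :
    P.IsAlmostStable ε (G.M : Set (Y × X)) := by
  refine ⟨isMatching_core hE hG, ?_⟩
  rw [ncard_edges hE]
  have hkpos : (0 : ℝ) < k := (by positivity : 0 < 8 / ε).trans_le hk
  have hLpos : (0 : ℝ) < L := (by positivity : 0 < 8 * k * α / ε).trans_le hL
  have h1 := card_blockingPairs_le hE hG
  have h1' : ((P.blockingPairs (G.M : Set (Y × X))).ncard : ℝ) * k ≤
      (E.filter fun e => e.1 ∈ G.bad).card * k + 2 * E.card +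
        (G.lost (quantW k P) E).card * k := by exact_mod_cast h1
  -- The fraction of bad men is at most `2k/L`, so their edges are a fraction of at most `2kα/L ≤
  -- ε/4`.
  have h2 : ((E.filter fun e => e.1 ∈ G.bad).card : ℝ) ≤ ε / 4 * E.card := by
    rcases (Fintype.card Y).eq_zero_or_pos with h0 | hpos
    · have : IsEmpty Y := Fintype.card_eq_zero_iff.1 h0
      have hE0 : E = ∅ := Finset.eq_empty_of_forall_notMem fun e _ => isEmptyElim e.1
      simp [hE0]
    · have hpos' : (0 : ℝ) < Fintype.card Y := by exact_mod_cast hpos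
      have h3 := card_edges_of_men hE hα G.bad
      have h4 : (L : ℝ) * G.bad.card ≤ 2 * k * Fintype.card Y := by exact_mod_cast hbad
      generalize ((E.filter fun e => e.1 ∈ G.bad).card : ℝ) = x at h3 ⊢
      have h5 : (L : ℝ) * (Fintype.card Y * x) ≤ 2 * k * Fintype.card Y * (α * E.card) := by
        refine (mul_le_mul_of_nonneg_left h3 hLpos.le).trans ?_
        rw [← mul_assoc]
        exact mul_le_mul_of_nonneg_right h4 (by positivity)
      have h6 : (L : ℝ) * x ≤ 2 * k * (α * E.card) := by
        refine le_of_mul_le_mul_left ?_ hpos'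
        linarith
      have h7 : 2 * k * (α * (E.card : ℝ)) ≤ L * (ε / 4 * E.card) := by
        rw [div_le_iff₀ hε] at hL
        have := mul_le_mul_of_nonneg_right hL (Nat.cast_nonneg E.card)
        linarith
      exact le_of_mul_le_mul_left (h6.trans h7) hLpos
  -- The pairs inside the quantile of a partner number at most `2|E|/k`, again at most `ε/4` of the
  -- edges.
  have h8 : 2 * (E.card : ℝ) ≤ ε / 4 * E.card * k := by
    rw [div_le_iff₀ hε] at hk
    have := mul_le_mul_of_nonneg_right hk (Nat.cast_nonneg E.card)
    linarith
  have h9 := mul_le_mul_of_nonneg_right h2 hkpos.le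
  have h10 := mul_le_mul_of_nonneg_right hlost hkpos.le
  refine le_of_mul_le_mul_right ?_ hkpos
  linarith

end Edges

/-! ### Success probability of the program and degenerate cases -/

open Classical in
/-- The algorithm fails with small probability. -/
theorem successProbability_callsProg {ε α : ℝ} {L T : ℕ} (hi : Function.Injective ident)
    (hXY : Fintype.card X = Fintype.card Y) (hYN : Fintype.card Y ≤ N) (hε : 0 < ε)
    (hα : P.IsAlmostRegular α) (hα1 : 1 ≤ α) (hk : 8 / ε ≤ k) (hL : 8 * k * α / ε ≤ L) :
    1 - L * k * (15 / 16) ^ T * (2 / ε) ≤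
      (algorithm k (callsProg T k L)).successProbability P ident N ε := by
  set E : Finset (Y × X) := Finset.univ.filter fun e => e.2 ∈ P.ofMan e.1 with hEdef
  have hE : ∀ e, e ∈ E ↔ e.2 ∈ P.ofMan e.1 := fun e => by simp [hEdef]
  have hkpos : (0 : ℝ) < k := (by positivity : 0 < 8 / ε).trans_le hk
  have hs : Setting k P ident N E :=
    ⟨by exact_mod_cast hkpos, hi, hE, hXY.trans_le hYN, hYN⟩
  rw [successProbability_algorithm]
  refine sub_le_sub_left ?_ 1
  set f : (Y ⊕ X → Loc) → ℝ := _
  change expect k P ident N (2 * N.factorial) (callsProg T k L) (ginit P ident N) f ≤ _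
  -- Markov's inequality: with this weight, `A` times the number of lost edges exceeds one as soon
  -- as the threshold is exceeded. For empty `E` the weight is zero, which is harmless because the
  -- threshold cannot be exceeded.
  set A : ℝ := (ε / 2 * E.card)⁻¹ with hA
  have hA0 : 0 ≤ A := by positivity
  have hbase : Setting.Bounded k P ident N E f A []
      (Setting.After k P (2 * k * Fintype.card Y) (0 + L)) 0 0 := by
    intro σ G h hG hpre
    rw [expect, zero_mul, add_zero, add_zero]
    have hbad : L * G.bad.card ≤ 2 * k * Fintype.card Y := by
      have := hpre.1
      rw [zero_add] at this
      omega
    by_cases hlost : ((G.lost (quantW k P) E).card : ℝ) ≤ ε / 2 * E.card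
    · have hf : f σ = 0 := if_pos ⟨(G.M : Set (Y × X)),
        isAlmostStable_of_lost_le hE hG hε hα hα1 hk hL hbad hlost, h.partnerM, h.partnerW⟩
      rw [hf]
      positivity
    · have hf : f σ ≤ 1 := by
        simp only [f]
        split_ifs <;> norm_num
      refine hf.trans ?_
      have hE0 : 0 < ε / 2 * (E.card : ℝ) := by
        rcases E.card.eq_zero_or_pos with h0 | hpos
        · refine absurd ?_ hlost
          have : (G.lost (quantW k P) E).card ≤ E.card :=
            Finset.card_le_card fun e he => (Core.mem_lost.1 he).1.1
          rw [h0] at this ⊢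
          rw [Nat.le_zero.1 this]
          simp
        · have : (0 : ℝ) < E.card := by exact_mod_cast hpos
          positivity
      rw [hA, inv_mul_eq_div, one_le_div hE0]
      exact (not_le.1 hlost).le
  have key := Setting.bounded_calls hs hA0 T _ L 0 hbase (ginit P ident N) (Core.start E)
    (rep_ginit hi hE) Core.inv_start ⟨by
      have h1 := Core.potW_le (qw := quantW k P) (G := Core.start E) k
      have h2 := Core.potM_le (qm := quantM k P) (G := Core.start E) hs.quantM_lt
      rw [hXY] at h1
      rw [zero_mul, zero_add]
      calc _ ≤ Fintype.card Y * k + Fintype.card Y * k := Nat.add_le_add h1 h2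
        _ = _ := by ring, rfl⟩
  refine key.trans ?_
  rw [Core.lost_start, Finset.card_empty, Nat.cast_zero, mul_zero, zero_mul, zero_add, zero_add]
  have hAE : A * E.card ≤ 2 / ε := by
    rcases E.card.eq_zero_or_pos with h0 | hpos
    · rw [h0, Nat.cast_zero, mul_zero]
      positivity
    · have : (0 : ℝ) < E.card := by exact_mod_cast hpos
      rw [hA]
      refine le_of_eq ?_
      field_simp
  calc (L : ℝ) * (k * (A * (15 / 16) ^ T * E.card))
      = L * k * (15 / 16) ^ T * (A * E.card) := by ring
    _ ≤ _ := by gcongr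

/-- An algorithm without rounds outputs the empty matching, which is `(1 - ε)`-stable for
`ε ≥ 1`. -/
theorem successProbability_nil {ε : ℝ} (hε : 1 ≤ ε) :
    1 ≤ (algorithm k []).successProbability P ident N ε := by
  classical
  rw [successProbability_algorithm, expect, if_pos, sub_zero]
  refine ⟨∅, ⟨⟨Set.empty_subset _, by simp⟩, ?_⟩, by simp [ginit, Loc.init], by
    simp [ginit, Loc.init]⟩
  have h1 : (P.blockingPairs ∅).ncard ≤ P.edges.ncard :=
    Set.ncard_le_ncard (fun e he => he.1) (Set.toFinite _)
  have h2 : ((P.blockingPairs ∅).ncard : ℝ) ≤ P.edges.ncard := by exact_mod_cast h1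
  exact h2.trans (le_mul_of_one_le_left (Nat.cast_nonneg _) hε)

theorem successProbability_nonneg (A : RandomizedAlgorithm) (ε : ℝ) :
    0 ≤ A.successProbability P ident N ε := by
  unfold RandomizedAlgorithm.successProbability
  positivity

theorem isAlmostRegular_of_isComplete {α : ℝ} (hα : 1 ≤ α) (h : P.IsComplete) :
    P.IsAlmostRegular α := by
  have hlen : ∀ m, (P.ofMan m).length = Fintype.card X := by
    intro m
    rw [← List.toFinset_card_of_nodup (P.nodup_ofMan m), ← Finset.card_univ]
    congr 1
    exact Finset.eq_univ_iff_forall.2 fun w => List.mem_toFinset.2 (h.2 m w)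
  intro m m'
  rw [hlen, hlen]
  exact le_mul_of_one_le_left (Nat.cast_nonneg _) hα

end Final

/-! ### The parameters -/

/-- The number of quantiles. -/
noncomputable def numQuantiles (ε : ℝ) : ℕ := ⌈8 / ε⌉₊

/-- The number of calls of the quantile matching. -/
noncomputable def numCalls (ε α : ℝ) : ℕ := ⌈8 * numQuantiles ε * α / ε⌉₊

/-- The number of iterations of the maximal matching procedure. -/
noncomputable def numIters (ε δ α : ℝ) : ℕ := ⌈256 * Real.log (2 + α / (δ * ε))⌉₊

/-- The algorithm for almost regular preferences. -/
noncomputable def almostRegularASM (ε δ α : ℝ) : RandomizedAlgorithm :=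
  -- Otherwise the empty matching suffices or nothing is required. Using no rounds is also needed
  -- there: the bound on the rounds tends to zero as `ε` grows.
  if ε < 1 ∧ δ < 1 then
    algorithm (numQuantiles ε) (callsProg (numIters ε δ α) (numQuantiles ε) (numCalls ε α))
  else algorithm 0 []

section Parameters

variable {ε δ α : ℝ}

/-- Each ceiling costs at most one, which `ε⁻¹` or `α * ε⁻²` absorbs: `9 = 8 + 1`, `73 = 8 * 9 + 1`,
`657 = 73 * 9`. -/
theorem calls_mul_quantiles_le (hε : 0 < ε) (hε1 : ε < 1) (hα : 1 ≤ α) :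
    (numCalls ε α : ℝ) * numQuantiles ε ≤ 657 * (α * (ε ^ 3)⁻¹) := by
  have hinv : 1 < ε⁻¹ := (one_lt_inv₀ hε).2 hε1
  have hk : (numQuantiles ε : ℝ) ≤ 9 * ε⁻¹ := by
    have := Nat.ceil_lt_add_one (by positivity : 0 ≤ 8 / ε)
    have h8 : 8 / ε = 8 * ε⁻¹ := div_eq_mul_inv 8 ε
    rw [numQuantiles]
    linarith
  have hL : (numCalls ε α : ℝ) ≤ 73 * (α * (ε⁻¹ * ε⁻¹)) := by
    have h1 := Nat.ceil_lt_add_one (by positivity : 0 ≤ 8 * numQuantiles ε * α / ε)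
    have h2 : 8 * numQuantiles ε * α / ε ≤ 72 * (α * (ε⁻¹ * ε⁻¹)) := by
      calc 8 * numQuantiles ε * α / ε = 8 * α * ε⁻¹ * numQuantiles ε := by ring
        _ ≤ 8 * α * ε⁻¹ * (9 * ε⁻¹) := by gcongr
        _ = _ := by ring
    have h3 : 1 ≤ α * (ε⁻¹ * ε⁻¹) :=
      one_le_mul_of_one_le_of_one_le hα (one_le_mul_of_one_le_of_one_le hinv.le hinv.le)
    rw [numCalls]
    linarith
  calc (numCalls ε α : ℝ) * numQuantiles ε
      ≤ 73 * (α * (ε⁻¹ * ε⁻¹)) * (9 * ε⁻¹) := by gcongr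
    _ = _ := by rw [← inv_pow]; ring

/-- The choice of `numIters` gives a factor `(2 + x)⁻¹⁶`. Four of these powers absorb `x * ε⁻³`, as
`ε⁻¹ ≤ x`, and twelve absorb the constant `1314 = 2 * 657`. -/
theorem failure_le (hε : 0 < ε) (hε1 : ε < 1) (hδ : 0 < δ) (hδ1 : δ < 1) (hα : 1 ≤ α) :
    (numCalls ε α : ℝ) * numQuantiles ε * (15 / 16) ^ numIters ε δ α * (2 / ε) ≤ δ := by
  set x := α / (δ * ε) with hx
  have hδε : δ * ε ≤ ε := by nlinarith
  have hδε' : δ * ε ≤ δ := by nlinarith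
  have hxε : ε⁻¹ ≤ x := by
    rw [hx, ← one_div]
    exact div_le_div₀ (by positivity) hα (by positivity) hδε
  have hx1 : 1 ≤ x := ((one_lt_inv₀ hε).2 hε1).le.trans hxε
  have hpow : ((15 : ℝ) / 16) ^ numIters ε δ α ≤ ((2 + x) ^ 16)⁻¹ := by
    have h1 : (15 : ℝ) / 16 ≤ Real.exp (-(1 / 16)) := by
      linarith [Real.add_one_le_exp (-(1 / 16) : ℝ)]
    have h2 : 256 * Real.log (2 + x) ≤ numIters ε δ α := Nat.le_ceil _
    calc ((15 : ℝ) / 16) ^ numIters ε δ α ≤ Real.exp (-(1 / 16)) ^ numIters ε δ α := by gcongr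
      _ = Real.exp (-(numIters ε δ α / 16)) := by
        rw [← Real.exp_nat_mul]
        congr 1
        ring
      _ ≤ Real.exp (-(16 * Real.log (2 + x))) := by
        gcongr
        linarith
      _ = ((2 + x) ^ 16)⁻¹ := by
        rw [Real.exp_neg, show (16 : ℝ) * Real.log (2 + x) = ((16 : ℕ) : ℝ) * Real.log (2 + x) by
          norm_num, Real.exp_nat_mul, Real.exp_log (by linarith)]
  have hmul : 1314 * (α * (ε ^ 3)⁻¹ * ε⁻¹) ≤ δ * (2 + x) ^ 16 := by
    have h1 : α * (ε ^ 3)⁻¹ * ε⁻¹ = δ * (x * ε⁻¹ ^ 3) := by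
      rw [hx]
      field_simp
    have h2 : x * ε⁻¹ ^ 3 ≤ (2 + x) ^ 4 := by
      calc x * ε⁻¹ ^ 3 ≤ x * x ^ 3 := by gcongr
        _ = x ^ 4 := by ring
        _ ≤ (2 + x) ^ 4 := by gcongr; linarith
    have h3 : (1314 : ℝ) ≤ (2 + x) ^ 12 := by
      calc (1314 : ℝ) ≤ 3 ^ 12 := by norm_num
        _ ≤ (2 + x) ^ 12 := by gcongr; linarith
    calc 1314 * (α * (ε ^ 3)⁻¹ * ε⁻¹) = δ * (1314 * (x * ε⁻¹ ^ 3)) := by rw [h1]; ring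
      _ ≤ δ * ((2 + x) ^ 12 * (2 + x) ^ 4) := by gcongr
      _ = _ := by ring
  have hpos : 0 < (2 + x) ^ 16 := by positivity
  have hLk := calls_mul_quantiles_le hε hε1 hα
  have hα0 : 0 ≤ α := by linarith
  calc (numCalls ε α : ℝ) * numQuantiles ε * (15 / 16) ^ numIters ε δ α * (2 / ε)
      ≤ 657 * (α * (ε ^ 3)⁻¹) * ((2 + x) ^ 16)⁻¹ * (2 / ε) :=
        mul_le_mul_of_nonneg_right
          (mul_le_mul hLk hpow (by positivity) (by positivity)) (by positivity)
    _ = 1314 * (α * (ε ^ 3)⁻¹ * ε⁻¹) * ((2 + x) ^ 16)⁻¹ := by ring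
    _ ≤ δ * (2 + x) ^ 16 * ((2 + x) ^ 16)⁻¹ := by gcongr
    _ = δ := by field_simp

theorem rounds_le (hε : 0 < ε) (hδ : 0 < δ) (hα : 1 ≤ α) :
    ((almostRegularASM ε δ α).rounds : ℝ) ≤
      1000000 * (α * (ε ^ 3)⁻¹ * Real.log (2 + α / (δ * ε))) := by
  have hx : 0 < α / (δ * ε) := by positivity
  have hlog : 0 ≤ Real.log (2 + α / (δ * ε)) := Real.log_nonneg (by linarith)
  rw [almostRegularASM]
  split_ifs with h
  · obtain ⟨hε1, hδ1⟩ := h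
    change ((callsProg _ _ _).length : ℝ) ≤ _
    rw [length_callsProg]
    have hx1 : 1 ≤ α / (δ * ε) := by
      rw [le_div_iff₀ (by positivity)]
      nlinarith
    -- The argument is at least `3 > e`. This lets the logarithm absorb additive constants, as in `4
    -- * 257 + 6 = 1034` below.
    have hl1 : 1 ≤ Real.log (2 + α / (δ * ε)) := by
      rw [Real.le_log_iff_exp_le (by linarith)]
      linarith [Real.exp_one_lt_d9]
    have hT : (numIters ε δ α : ℝ) ≤ 257 * Real.log (2 + α / (δ * ε)) := by
      have := Nat.ceil_lt_add_one
        (by positivity : 0 ≤ 256 * Real.log (2 + α / (δ * ε)))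
      rw [numIters]
      linarith
    have hk : (1 : ℝ) ≤ numQuantiles ε := by
      have : 0 < numQuantiles ε := Nat.ceil_pos.2 (by positivity)
      exact_mod_cast this
    have hLk := calls_mul_quantiles_le hε hε1 hα
    push_cast
    generalize Real.log (2 + α / (δ * ε)) = l at *
    calc (numCalls ε α : ℝ) * (numQuantiles ε * (4 * numIters ε δ α + 5) + 1)
        ≤ numCalls ε α * (numQuantiles ε * (4 * numIters ε δ α + 5) + numQuantiles ε) := by
          gcongr
      _ = numCalls ε α * numQuantiles ε * (4 * numIters ε δ α + 6) := by ring
      _ ≤ 657 * (α * (ε ^ 3)⁻¹) * (1034 * l) := by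
          gcongr
          linarith
      _ = 679338 * (α * (ε ^ 3)⁻¹ * l) := by ring
      _ ≤ _ := by
          gcongr
          norm_num
  · change (((([] : List Instr).length : ℕ) : ℝ)) ≤ _
    simp only [List.length_nil, Nat.cast_zero]
    positivity

end Parameters

end QuantileMatching

theorem mainTheorem4 :
    ∃ (C : ℝ) (c : ℕ) (almostRegularASM : ℝ → ℝ → ℝ → RandomizedAlgorithm),
      ∀ ε δ α : ℝ, 0 < ε → 0 < δ → 1 ≤ α →
        ((almostRegularASM ε δ α).rounds : ℝ) ≤
            C * (α * (ε ^ 3)⁻¹ * Real.log (2 + α / (δ * ε))) ∧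
        ∀ (n N : ℕ) (X Y : Type) [Fintype X] [Fintype Y] [DecidableEq X] [DecidableEq Y]
          (ident : Y ⊕ X → ℕ) (P : Preferences X Y),
          Fintype.card X = n → Fintype.card Y = n → n ≤ N → Function.Injective ident →
            (almostRegularASM ε δ α).RespectsBandwidth P ident N (c * (Nat.log 2 n + 1)) ∧
            (P.IsAlmostRegular α →
              1 - δ ≤ (almostRegularASM ε δ α).successProbability P ident N ε) ∧
            (P.IsComplete → P.IsAlmostRegular α) := by
  refine ⟨1000000, 1, QuantileMatching.almostRegularASM, fun ε δ α hε hδ hα =>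
    ⟨QuantileMatching.rounds_le hε hδ hα, ?_⟩⟩
  intro n N X Y _ _ _ _ ident P hX hY hN hi
  refine ⟨?_, fun hreg => ?_, QuantileMatching.isAlmostRegular_of_isComplete hα⟩
  · rw [QuantileMatching.almostRegularASM]
    split_ifs
    · exact QuantileMatching.respectsBandwidth_algorithm _ _ _ _ _ _ (by omega)
    · exact QuantileMatching.respectsBandwidth_algorithm _ _ _ _ _ _ (by omega)
  · by_cases h : ε < 1 ∧ δ < 1
    · rw [QuantileMatching.almostRegularASM, if_pos h]
      refine le_trans ?_ (QuantileMatching.successProbability_callsProg hi (hX.trans hY.symm)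
        (hY.trans_le hN) hε hreg hα (Nat.le_ceil _) (Nat.le_ceil _))
      exact sub_le_sub_left (QuantileMatching.failure_le hε h.1 hδ h.2 hα) 1
    · rw [QuantileMatching.almostRegularASM, if_neg h]
      rcases not_and_or.1 h with h | h
      · exact (by linarith : 1 - δ ≤ 1).trans
          (QuantileMatching.successProbability_nil (not_lt.1 h))
      · exact (by linarith [not_lt.1 h] : 1 - δ ≤ 0).trans
          (QuantileMatching.successProbability_nonneg _ _)
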